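/- Let $F=(F_1,F_2)$ be a holomorphic automorphism of $\mathbb{C}^2$ with $F(0)=0$, $F'(0)=\mathrm{Id}$ and, as $(z,w)\to(0,0)$, $$F(z,w)=\Bigl(z+z^2+O(z^3,z^2w),\; w-w^2z-\tfrac{z^4}{3}+\tfrac{8z^3w}{3}+O(z^5,z^4w,z^2w^2,zw^3)\Bigr),$$ where $O(m_1,\dots,m_j)$ stands for $O(|m_1|+\dots+|m_j|)$. For $\varepsilon>0$ put $$V_\varepsilon=\{z\in\mathbb{C}: 0<|z|<\varepsilon,\ |\operatorname{Arg}(z)-\pi|<\pi/8\},\qquad \operatorname{Arg}(z)\in[0,2\pi).$$ A *parabolic curve* for $F$ at the origin is an injective holomorphic map $\phi:\Delta\to\mathbb{C}^2$ on a simply connected domain $\Delta\subset\mathbb{C}$ with $0\in\partial\Delta$, continuous at $0$ with $\phi(0)=0$, such that $F(\phi(\Delta))\subset\phi(\Delta)$ and $F^n\to 0$ locally uniformly on $\phi(\Delta)$; it is *tangent* to $[v]\in\mathbb{P}^1$ if $[\phi(\zeta)]\to[v]$ as $\zeta\to0$ in $\Delta$. Writing $F=\mathrm{id}+P_k+P_{k+1}+\cdots$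 with $P_h$ homogeneous of degree $h$, $k\ge2$ and $P_k\not\equiv0$, a direction $[v]$ is a *nondegenerate characteristic direction* of $F$ if $P_k(v)=\lambda v$ for some $\lambda\neq0$. Then $(1,0)$ is a nondegenerate characteristic direction of $F$, and there are $\varepsilon_0>0$, a function $\gamma$ with values in $\mathbb{C}$ defined on $\overline{V_{\varepsilon_0}}$, and positive constants $C_1,C_2$ such that for every $0<\varepsilon\le\varepsilon_0$: 1. $\gamma$ is holomorphic in $V_\varepsilon$, continuous on $\overline{V_\varepsilon}$, and $\gamma(0)=0$; 2. $z\mapsto(z,\gamma(z))$, $z\in V_\varepsilon$, is a parabolic curve for $F$ at the origin, tangent to $[(1,0)]$; 3. if $p\in\mathcal{C}=\{(z,\gamma(z)): z\in V_\varepsilon\}$, then $F(p)\in\mathcal{C}$, $F^n(p)\to0$ and $[F^n(p)]\to[(1,0)]$ as $n\to\infty$; 4. $|\gamma(z)|\le C_1|z|^3$ and $|\gamma'(z)|\le C_2|z|^2$ for all $z\in V_\varepsilon$. -/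

import Mathlib

open Filter Topology Asymptotics

noncomputable section

namespace ParabolicCurve

/-- `F` is a (holomorphic) automorphism of `ℂ²`: an entire bijection with entire inverse. -/
def IsAutomorphism (F : ℂ × ℂ → ℂ × ℂ) : Prop :=
  Differentiable ℂ F ∧
    ∃ G : ℂ × ℂ → ℂ × ℂ, Differentiable ℂ G ∧ Function.LeftInverse G F ∧ Function.RightInverse G F

/-- `F` is an automorphism of `ℂ²` with `F(0) = 0`, `F'(0) = Id` and, near the origin,
`F(z,w) = (z + z² + O(z³, z²w),
  w - w²z - z⁴/3 + 8z³w/3 + O(z⁵, z⁴w, z²w², zw³))`.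
Here `O(m₁, …, mⱼ)` means `O(|m₁| + ⋯ + |mⱼ|)` as `(z,w) → (0,0)`. -/
structure IsSpecialAutomorphism (F : ℂ × ℂ → ℂ × ℂ) : Prop where
  isAutomorphism : IsAutomorphism F
  map_zero : F 0 = 0
  hasFDerivAt_zero : HasFDerivAt F (ContinuousLinearMap.id ℂ (ℂ × ℂ)) 0
  fst_expansion :
    (fun p : ℂ × ℂ => (F p).1 - (p.1 + p.1 ^ 2)) =O[𝓝 0]
      (fun p : ℂ × ℂ => ‖p.1 ^ 3‖ + ‖p.1 ^ 2 * p.2‖)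
  snd_expansion :
    (fun p : ℂ × ℂ =>
        (F p).2 - (p.2 - p.2 ^ 2 * p.1 - p.1 ^ 4 / 3 + 8 * p.1 ^ 3 * p.2 / 3)) =O[𝓝 0]
      (fun p : ℂ × ℂ =>
        ‖p.1 ^ 5‖ + ‖p.1 ^ 4 * p.2‖ + ‖p.1 ^ 2 * p.2 ^ 2‖ + ‖p.1 * p.2 ^ 3‖)

/-- The value at `v` of the homogeneous part `P_h` of degree `h` of the Taylor expansion at `0`
of a map `F` holomorphic near `0`: the coefficient of `t ^ h` in `F (t • v)`. -/
def homogeneousPart (F : ℂ × ℂ → ℂ × ℂ) (h : ℕ) (v : ℂ × ℂ) : ℂ × ℂ :=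
  (h.factorial : ℂ)⁻¹ • iteratedDeriv h (fun t : ℂ => F (t • v)) 0

/-- For `F = id + P_k + P_{k+1} + ⋯` with `k ≥ 2` and `P_k ≢ 0`, the direction `[v]` is a
nondegenerate characteristic direction: `P_k(v) = λ v` with `λ ≠ 0`. -/
def IsNondegenerateCharacteristicDirection (F : ℂ × ℂ → ℂ × ℂ) (v : ℂ × ℂ) : Prop :=
  v ≠ 0 ∧ ∃ k : ℕ, 2 ≤ k ∧
    (∀ h : ℕ, 2 ≤ h → h < k → ∀ u, homogeneousPart F h u = 0) ∧
    (∃ u, homogeneousPart F k u ≠ 0) ∧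
    ∃ lam : ℂ, lam ≠ 0 ∧ homogeneousPart F k v = lam • v

/-- The convergence `[f i] → [v]` in the projective line of complex directions of `ℂ²`, along the
filter `l`: suitable complex multiples of `f i` converge to the nonzero vector `v` (in
particular these multiples, and hence `f i`, are eventually nonzero). -/
def TendstoDirection {ι : Type*} (f : ι → ℂ × ℂ) (l : Filter ι) (v : ℂ × ℂ) : Prop :=
  v ≠ 0 ∧ ∃ c : ι → ℂ, Tendsto (fun i => c i • f i) l (𝓝 v)

/-- `φ : Δ → ℂ²` is a parabolic curve for `F` at the origin. The iterates of `F` converge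
to `0` on `φ(Δ)` in the usual sense of holomorphic maps, that is, locally uniformly. -/
structure IsParabolicCurve (F : ℂ × ℂ → ℂ × ℂ) (Δ : Set ℂ) (φ : ℂ → ℂ × ℂ) : Prop where
  isOpen : IsOpen Δ
  isSimplyConnected : IsSimplyConnected Δ
  zero_mem_frontier : (0 : ℂ) ∈ frontier Δ
  differentiableOn : DifferentiableOn ℂ φ Δ
  injOn : Set.InjOn φ Δ
  continuousWithinAt_zero : ContinuousWithinAt φ Δ 0
  map_zero : φ 0 = 0
  mapsTo : Set.MapsTo F (φ '' Δ) (φ '' Δ)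
  tendsto_zero : TendstoLocallyUniformlyOn (fun n : ℕ => F^[n]) (fun _ => 0) atTop (φ '' Δ)

/-- The parabolic curve `φ` is tangent to `[v]` at the origin: `[φ(ζ)] → [v]` as `ζ → 0` in `Δ`. -/
def IsTangentAtOrigin (Δ : Set ℂ) (φ : ℂ → ℂ × ℂ) (v : ℂ × ℂ) : Prop :=
  TendstoDirection φ (𝓝[Δ] 0) v

/-- The sector `V_ε = {z : 0 < |z| < ε, |Arg z - π| < π/8}`, where `Arg` takes values in
`[0, 2π)`, so that `Arg z - π` is the principal argument of `-z`, except that it is `-π`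
instead of `π` for `z > 0`. -/
def sector (ε : ℝ) : Set ℂ :=
  {z : ℂ | 0 < ‖z‖ ∧ ‖z‖ < ε ∧ |Complex.arg (-z)| < Real.pi / 8}

/-- The curve `C = {(z, γ(z)) : z ∈ V_ε}`. -/
def curve (γ : ℂ → ℂ) (ε : ℝ) : Set (ℂ × ℂ) :=
  (fun z => (z, γ z)) '' sector ε

end ParabolicCurve

end

noncomputable section

namespace ParabolicCurve

/-! In the coordinate `x = -1 / z`, where small `z` near the negative axis become `x` with large
real part, `F` is a perturbed translation `(x, w) ↦ (x + 1 + a, w + H)` with `a = O(|x|⁻¹ + |w|)`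
and `H = O(|x|⁻⁴ + |w|² |x|⁻¹)`. The term `z³w` is absorbed into `H` by an inequality of
arithmetic–geometric type, so only these sizes matter, not the precise coefficients.

The curve consists of the starting points of orbits with `w_n → 0`. Such an orbit over `x` satisfies
`x_n = x + n + ∑_{k<n} a` and `w_n = -∑_{k≥n} H`, a fixed-point equation (Lyapunov–Perron). Its
right-hand side contracts a weighted distance by `1/2` (`isClose_lyapunovPerron`), so an admissible
solution exists and is unique. Let `Γ x` be its `w_0`. Uniqueness makes the shifted orbit the one
attached to `x_1`, so the graph of `Γ` is invariant; `Γ` is holomorphic as a uniform limit of Picard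
iterates; summing the bound on `H` gives `Γ = O((Re x)⁻³)`
(`PerturbationBounds.exists_invariant_graph`).

The required Lipschitz bounds on `a` and `H` follow from their sizes by Cauchy estimates
(`exists_perturbationBounds`). Back in `z`, the graph lives over a cone wider than the sector, which
gives continuity on the closure and, by Cauchy, the bound on `γ'`. The sector is invariant because
`|a| ≤ 1/5` is small against its opening (`step_mem_sector`), and `Re x_n ≥ n / 2` forces orbits to
`0` uniformly. -/

lemma exists_hasSum_inv_pow_four {t : ℝ} (ht : 1 ≤ t) :
    ∃ s ≤ 4 * (t ^ 3)⁻¹, HasSum (fun k : ℕ => ((t + k / 2) ^ 4)⁻¹) s := by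
  set f : ℕ → ℝ := fun k => (t + k / 2 - 1 / 2)⁻¹ with hf
  have hpos : ∀ k : ℕ, 0 < t + k / 2 - 1 / 2 := fun k => by
    have : (0 : ℝ) ≤ k := k.cast_nonneg
    linarith
  -- Telescoping controls two of the four powers; the other two are bounded by `t⁻²` below.
  have hle : ∀ k : ℕ, ((t + k / 2) ^ 2)⁻¹ ≤ 2 * (f k - f (k + 1)) := fun k => by
    have h := hpos k
    have h2 : 0 < t + k / 2 := by linarith
    have e : 2 * (f k - f (k + 1)) = ((t + k / 2 - 1 / 2) * (t + k / 2))⁻¹ := by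
      have : t + ((k + 1 : ℕ) : ℝ) / 2 - 1 / 2 = t + k / 2 := by push_cast; ring
      simp only [hf, this]
      rw [inv_sub_inv h.ne' h2.ne', mul_inv]
      field_simp
      ring
    rw [e]
    apply inv_anti₀ (by positivity)
    nlinarith
  have hlim : Tendsto f atTop (𝓝 0) := by
    apply tendsto_inv_atTop_zero.comp
    refine tendsto_atTop_mono' _ ?_ (tendsto_natCast_atTop_atTop.atTop_div_const (two_pos))
    filter_upwards with k
    linarith
  have hsum : HasSum (fun k : ℕ => 2 * (f k - f (k + 1))) (2 * f 0) := by
    apply HasSum.mul_left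
    rw [hasSum_iff_tendsto_nat_of_nonneg]
    · simp_rw [Finset.sum_range_sub']
      simpa using hlim.const_sub (f 0)
    · intro k
      have : 0 ≤ ((t + k / 2) ^ 2)⁻¹ := by positivity
      linarith [hle k]
  have hsum' := hsum.mul_left (t ^ 2)⁻¹
  have hle' : ∀ k : ℕ, ((t + k / 2) ^ 4)⁻¹ ≤ (t ^ 2)⁻¹ * (2 * (f k - f (k + 1))) := fun k => by
    refine le_trans ?_ (mul_le_mul_of_nonneg_left (hle k) (by positivity))
    rw [← mul_inv]
    apply inv_anti₀ (by positivity)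
    have : (0 : ℝ) ≤ k := k.cast_nonneg
    have h2 : t ≤ t + k / 2 := by linarith
    have : t ^ 2 ≤ (t + k / 2) ^ 2 := by gcongr
    nlinarith [sq_nonneg (t + k / 2)]
  have hs : Summable fun k : ℕ => ((t + k / 2) ^ 4)⁻¹ :=
    .of_nonneg_of_le (fun k => by positivity) hle' hsum'.summable
  refine ⟨_, ?_, hs.hasSum⟩
  refine (hasSum_le hle' hs.hasSum hsum').trans ?_
  have h0 : f 0 ≤ 2 * t⁻¹ := by
    simp only [hf, Nat.cast_zero, zero_div, add_zero]
    rw [← div_eq_mul_inv, inv_le_comm₀ (by linarith) (by positivity), inv_div]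
    linarith
  calc (t ^ 2)⁻¹ * (2 * f 0) ≤ (t ^ 2)⁻¹ * (2 * (2 * t⁻¹)) := by gcongr
    _ = 4 * (t ^ 3)⁻¹ := by field_simp; norm_num

/-! ### The Lyapunov–Perron fixed point and the invariant graph over a half plane. -/

/-- The pairs `(x, w)` with `Re x ≥ ρ` and `|w| ≤ ρ⁻²`. -/
def box (ρ : ℝ) : Set (ℂ × ℂ) := {p | ρ ≤ p.1.re ∧ ‖p.2‖ ≤ (ρ ^ 2)⁻¹}

lemma box_anti {ρ σ : ℝ} (hρ : 0 < ρ) (h : ρ ≤ σ) : box σ ⊆ box ρ := fun _ hp =>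
  ⟨h.trans hp.1, hp.2.trans (by gcongr)⟩

/-- Bounds on the perturbation `(a, H)` of the map `(x, w) ↦ (x + 1, w)`. -/
structure PerturbationBounds (a H : ℂ × ℂ → ℂ) (L R : ℝ) : Prop where
  one_le : 1 ≤ R
  nonneg : 0 ≤ L
  mul_le : 16 * L ≤ R
  differentiableAt_a : ∀ p : ℂ × ℂ, R < p.1.re → ‖p.2‖ < (R ^ 2)⁻¹ → DifferentiableAt ℂ a p
  differentiableAt_H : ∀ p : ℂ × ℂ, R < p.1.re → ‖p.2‖ < (R ^ 2)⁻¹ → DifferentiableAt ℂ H p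
  norm_a_le : ∀ p ∈ box R, ‖a p‖ ≤ 1 / 5
  norm_H_le : ∀ ρ, R ≤ ρ → ∀ p ∈ box ρ, ‖H p‖ ≤ L * (ρ ^ 4)⁻¹
  norm_a_sub_le : ∀ ρ, R ≤ ρ → ∀ p ∈ box ρ, ∀ q ∈ box ρ,
    ‖a p - a q‖ ≤ L * ((ρ ^ 2)⁻¹ * ‖p.1 - q.1‖ + ‖p.2 - q.2‖)
  norm_H_sub_le : ∀ ρ, R ≤ ρ → ∀ p ∈ box ρ, ∀ q ∈ box ρ,
    ‖H p - H q‖ ≤ L * ((ρ ^ 5)⁻¹ * ‖p.1 - q.1‖ + (ρ ^ 2)⁻¹ * ‖p.2 - q.2‖)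

/-- Sequences with the growth and decay of an orbit on the parabolic curve. -/
def IsAdmissible (r : ℝ) (p : ℕ → ℂ × ℂ) : Prop := ∀ n : ℕ, p n ∈ box (r + n / 2)

/-- `p` and `q` are at weighted distance at most `d`. -/
def IsClose (r d : ℝ) (p q : ℕ → ℂ × ℂ) : Prop := ∀ n : ℕ,
  ‖(p n).1 - (q n).1‖ ≤ d * (r + n / 2) ∧ ‖(p n).2 - (q n).2‖ ≤ d * ((r + n / 2) ^ 2)⁻¹

/-- The Lyapunov–Perron operator: its fixed points are the orbits of
`(x, w) ↦ (x + 1 + a, w + H)` starting over `x` whose second component tends to `0`. -/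
def lyapunovPerron (a H : ℂ × ℂ → ℂ) (x : ℂ) (p : ℕ → ℂ × ℂ) (n : ℕ) : ℂ × ℂ :=
  (x + n + ∑ k ∈ Finset.range n, a (p k), -∑' k, H (p (n + k)))

/-- Picard iterates of the Lyapunov–Perron operator. -/
def picard (a H : ℂ × ℂ → ℂ) (x : ℂ) : ℕ → ℕ → ℂ × ℂ
  | 0 => fun n => (x + n, 0)
  | m + 1 => lyapunovPerron a H x (picard a H x m)

namespace PerturbationBounds

variable {a H : ℂ × ℂ → ℂ} {L R : ℝ} {x : ℂ} {p q : ℕ → ℂ × ℂ}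

lemma le_add_natCast_div_two {r : ℝ} (hr : R ≤ r) (n : ℕ) : R ≤ r + n / 2 := by
  have : (0 : ℝ) ≤ n := n.cast_nonneg
  linarith

lemma norm_a_comp_le (hb : PerturbationBounds a H L R) {r : ℝ} (hr : R ≤ r)
    (hp : IsAdmissible r p) (n : ℕ) : ‖a (p n)‖ ≤ 1 / 5 :=
  hb.norm_a_le _ (box_anti (by linarith [hb.one_le]) (le_add_natCast_div_two hr n) (hp n))

lemma exists_hasSum (hb : PerturbationBounds a H L R) {r : ℝ} (hr : R ≤ r) (n : ℕ) (c : ℝ)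
    (hc : 0 ≤ c) : ∃ s ≤ c * (4 * ((r + n / 2) ^ 3)⁻¹),
      HasSum (fun k : ℕ => c * ((r + ((n + k : ℕ) : ℝ) / 2) ^ 4)⁻¹) s := by
  obtain ⟨s, hs, hsum⟩ := exists_hasSum_inv_pow_four (hb.one_le.trans (le_add_natCast_div_two hr n))
  refine ⟨c * s, by gcongr, ?_⟩
  have e : ∀ k : ℕ, r + ((n + k : ℕ) : ℝ) / 2 = r + n / 2 + k / 2 := fun k => by push_cast; ring
  simpa only [e] using hsum.mul_left c

lemma summable_H (hb : PerturbationBounds a H L R) {r : ℝ} (hr : R ≤ r)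
    (hp : IsAdmissible r p) (n : ℕ) : Summable fun k => H (p (n + k)) := by
  obtain ⟨s, -, hs⟩ := hb.exists_hasSum hr n L hb.nonneg
  exact .of_norm_bounded hs.summable fun k => hb.norm_H_le _ (le_add_natCast_div_two hr _) _ (hp _)

/-- One power better than admissibility demands. The gain keeps the operator inside the admissible
sequences and is the source of the cubic bound on the curve. -/
lemma norm_snd_lyapunovPerron_le (hb : PerturbationBounds a H L R) {r : ℝ} (hr : R ≤ r)
    (hp : IsAdmissible r p) (n : ℕ) :
    ‖(lyapunovPerron a H x p n).2‖ ≤ 4 * L * ((r + n / 2) ^ 3)⁻¹ := by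
  obtain ⟨s, hs, hsum⟩ := hb.exists_hasSum hr n L hb.nonneg
  rw [lyapunovPerron, norm_neg]
  refine (tsum_of_norm_bounded hsum fun k =>
    hb.norm_H_le _ (le_add_natCast_div_two hr _) _ (hp _)).trans (hs.trans (by linarith))

lemma isAdmissible_lyapunovPerron (hb : PerturbationBounds a H L R) (hx : R ≤ x.re)
    (hp : IsAdmissible x.re p) : IsAdmissible x.re (lyapunovPerron a H x p) := fun n => by
  have hρ := le_add_natCast_div_two hx n
  have hR := hb.one_le
  constructor
  · have h1 : ‖∑ k ∈ Finset.range n, a (p k)‖ ≤ n * (1 / 5) := by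
      refine (norm_sum_le_of_le _ fun k _ => hb.norm_a_comp_le hx hp k).trans ?_
      simp
    have h2 := (Complex.abs_re_le_norm _).trans h1
    have h3 := (abs_le.1 h2).1
    have : (0 : ℝ) ≤ n := n.cast_nonneg
    simp only [lyapunovPerron, Complex.add_re, Complex.natCast_re]
    linarith
  · refine (hb.norm_snd_lyapunovPerron_le hx hp n).trans ?_
    set ρ := x.re + n / 2
    have h0 : 0 < ρ := by linarith
    have : 4 * L * (ρ ^ 3)⁻¹ = (4 * L / ρ) * (ρ ^ 2)⁻¹ := by field_simp
    rw [this]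
    refine mul_le_of_le_one_left (by positivity) ?_
    rw [div_le_one h0]
    linarith [hb.mul_le, hb.nonneg]

lemma isAdmissible_picard (hb : PerturbationBounds a H L R) (hx : R ≤ x.re) (m : ℕ) :
    IsAdmissible x.re (picard a H x m) := by
  induction m with
  | zero =>
    intro n
    have : (0 : ℝ) ≤ n := n.cast_nonneg
    refine ⟨?_, ?_⟩
    · simp only [picard, Complex.add_re, Complex.natCast_re]
      linarith
    · simp only [picard, norm_zero]
      positivity
  | succ m ih => exact hb.isAdmissible_lyapunovPerron hx ih

/-- The weights are chosen for this contraction. Differences of `a` are at most `d / 4` each and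
accumulate linearly, which the growing weight on the first component allows; differences of `H` are
`O(d ρ⁻⁴)`, with tail sums `O(d ρ⁻³)`, and the spare factor `L / ρ` is small by `16 * L ≤ R`. -/
lemma isClose_lyapunovPerron (hb : PerturbationBounds a H L R) (hx : R ≤ x.re)
    (hp : IsAdmissible x.re p) (hq : IsAdmissible x.re q) {d : ℝ} (hd : 0 ≤ d)
    (hpq : IsClose x.re d p q) :
    IsClose x.re (d / 2) (lyapunovPerron a H x p) (lyapunovPerron a H x q) := fun n => by
  have hR := hb.one_le
  have hL := hb.nonneg
  have hLR := hb.mul_le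
  have hρ := le_add_natCast_div_two hx n
  have hn : (0 : ℝ) ≤ n := n.cast_nonneg
  constructor
  · have h : ∀ k, ‖a (p k) - a (q k)‖ ≤ d / 4 := fun k => by
      have hk := le_add_natCast_div_two hx k
      refine (hb.norm_a_sub_le _ hk _ (hp k) _ (hq k)).trans ?_
      obtain ⟨h1, h2⟩ := hpq k
      set ρ := x.re + k / 2
      have h0 : 0 < ρ := by linarith
      calc L * ((ρ ^ 2)⁻¹ * ‖(p k).1 - (q k).1‖ + ‖(p k).2 - (q k).2‖)
          ≤ L * ((ρ ^ 2)⁻¹ * (d * ρ) + d * (ρ ^ 2)⁻¹) := by gcongr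
        _ = L * d * (ρ ^ 2)⁻¹ * (ρ + 1) := by ring
        _ ≤ L * d * (ρ ^ 2)⁻¹ * (2 * ρ) := by gcongr; linarith
        _ = (2 * L / ρ) * d := by field_simp
        _ ≤ (1 / 4) * d := by
          refine mul_le_mul_of_nonneg_right ?_ hd
          rw [div_le_iff₀ h0]
          linarith
        _ = d / 4 := by ring
    simp only [lyapunovPerron, add_sub_add_left_eq_sub, ← Finset.sum_sub_distrib]
    refine (norm_sum_le_of_le _ fun k _ => h k).trans ?_
    simp only [Finset.sum_const, Finset.card_range, nsmul_eq_mul]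
    nlinarith
  · obtain ⟨s, hs, hsum⟩ := hb.exists_hasSum hx n (2 * L * d) (by positivity)
    have h : ∀ k, ‖H (p (n + k)) - H (q (n + k))‖ ≤
        2 * L * d * ((x.re + ((n + k : ℕ) : ℝ) / 2) ^ 4)⁻¹ := fun k => by
      have hk := le_add_natCast_div_two hx (n + k)
      refine (hb.norm_H_sub_le _ hk _ (hp _) _ (hq _)).trans ?_
      obtain ⟨h1, h2⟩ := hpq (n + k)
      set ρ := x.re + ((n + k : ℕ) : ℝ) / 2
      have h0 : 0 < ρ := by linarith
      calc L * ((ρ ^ 5)⁻¹ * ‖(p (n + k)).1 - (q (n + k)).1‖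
            + (ρ ^ 2)⁻¹ * ‖(p (n + k)).2 - (q (n + k)).2‖)
          ≤ L * ((ρ ^ 5)⁻¹ * (d * ρ) + (ρ ^ 2)⁻¹ * (d * (ρ ^ 2)⁻¹)) := by gcongr
        _ = 2 * L * d * (ρ ^ 4)⁻¹ := by field_simp; norm_num
    have e : (lyapunovPerron a H x p n).2 - (lyapunovPerron a H x q n).2 =
        -∑' k, (H (p (n + k)) - H (q (n + k))) := by
      rw [(hb.summable_H hx hp n).tsum_sub (hb.summable_H hx hq n)]
      simp only [lyapunovPerron]
      ring
    rw [e, norm_neg]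
    refine (tsum_of_norm_bounded hsum h).trans (hs.trans ?_)
    set ρ := x.re + n / 2
    have h0 : 0 < ρ := by linarith
    calc 2 * L * d * (4 * (ρ ^ 3)⁻¹) = (8 * L / ρ) * d * (ρ ^ 2)⁻¹ := by field_simp; ring
      _ ≤ (1 / 2) * d * (ρ ^ 2)⁻¹ := by
        refine mul_le_mul_of_nonneg_right (mul_le_mul_of_nonneg_right ?_ hd) (by positivity)
        rw [div_le_iff₀ h0]
        linarith
      _ = d / 2 * (ρ ^ 2)⁻¹ := by ring

lemma isClose_lyapunovPerron_two (hb : PerturbationBounds a H L R) (hx : R ≤ x.re)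
    (hp : IsAdmissible x.re p) (hq : IsAdmissible x.re q) :
    IsClose x.re 2 (lyapunovPerron a H x p) (lyapunovPerron a H x q) := fun n => by
  have hn : (0 : ℝ) ≤ n := n.cast_nonneg
  have hR := hb.one_le
  constructor
  · simp only [lyapunovPerron, add_sub_add_left_eq_sub, ← Finset.sum_sub_distrib]
    refine (norm_sum_le_of_le _ fun k _ => (norm_sub_le _ _).trans
      (add_le_add (hb.norm_a_comp_le hx hp k) (hb.norm_a_comp_le hx hq k))).trans ?_
    simp only [Finset.sum_const, Finset.card_range, nsmul_eq_mul]
    linarith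
  · refine (norm_sub_le _ _).trans ?_
    rw [two_mul]
    exact add_le_add (hb.isAdmissible_lyapunovPerron hx hp n).2
      (hb.isAdmissible_lyapunovPerron hx hq n).2

lemma isClose_picard_succ (hb : PerturbationBounds a H L R) (hx : R ≤ x.re) (m : ℕ) :
    IsClose x.re (2 * (1 / 2) ^ m) (picard a H x m) (picard a H x (m + 1)) := by
  induction m with
  | zero =>
    intro n
    have hn : (0 : ℝ) ≤ n := n.cast_nonneg
    have hR := hb.one_le
    have h0 := hb.isAdmissible_picard hx 0
    have h1 := hb.isAdmissible_picard hx 1 n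
    have hpos : 0 ≤ ((x.re + n / 2) ^ 2)⁻¹ := by positivity
    constructor
    · simp only [picard, lyapunovPerron, sub_add_cancel_left, norm_neg]
      refine (norm_sum_le_of_le _ fun k _ => hb.norm_a_comp_le hx h0 k).trans ?_
      simp only [Finset.sum_const, Finset.card_range, nsmul_eq_mul]
      linarith
    · have : (picard a H x 0 n).2 = 0 := rfl
      rw [this, zero_sub, norm_neg]
      linarith [h1.2]
  | succ m ih =>
    have h := hb.isClose_lyapunovPerron hx (hb.isAdmissible_picard hx m)
      (hb.isAdmissible_picard hx (m + 1)) (by positivity) ih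
    have e : 2 * (1 / 2 : ℝ) ^ (m + 1) = 2 * (1 / 2) ^ m / 2 := by ring
    rw [e]
    exact h

/-- Two fixed points are at distance at most `2` by admissibility alone, and applying the operator
halves this indefinitely. -/
lemma eq_of_isFixedPt (hb : PerturbationBounds a H L R) (hx : R ≤ x.re)
    (hp : IsAdmissible x.re p) (hq : IsAdmissible x.re q)
    (hfp : lyapunovPerron a H x p = p) (hfq : lyapunovPerron a H x q = q) : p = q := by
  have h : ∀ m : ℕ, IsClose x.re (2 * (1 / 2) ^ m) p q := fun m => by
    induction m with
    | zero => simpa [hfp, hfq] using hb.isClose_lyapunovPerron_two hx hp hq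
    | succ m ih =>
      have h := hb.isClose_lyapunovPerron hx hp hq (by positivity) ih
      rw [hfp, hfq] at h
      have e : 2 * (1 / 2 : ℝ) ^ (m + 1) = 2 * (1 / 2) ^ m / 2 := by ring
      rwa [e]
  have hlim : ∀ c : ℝ, Tendsto (fun m : ℕ => 2 * (1 / 2 : ℝ) ^ m * c) atTop (𝓝 0) := fun c => by
    simpa using ((tendsto_pow_atTop_nhds_zero_of_lt_one (r := (1 / 2 : ℝ)) (by norm_num)
      (by norm_num)).const_mul 2).mul_const c
  ext n : 1
  refine Prod.ext ?_ ?_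
  · exact sub_eq_zero.1 (norm_le_zero_iff.1 (ge_of_tendsto' (hlim _) fun m => (h m n).1))
  · exact sub_eq_zero.1 (norm_le_zero_iff.1 (ge_of_tendsto' (hlim _) fun m => (h m n).2))

lemma exists_isFixedPt (hb : PerturbationBounds a H L R) (hx : R ≤ x.re) :
    ∃ q, IsAdmissible x.re q ∧ lyapunovPerron a H x q = q ∧
      ∀ m, IsClose x.re (4 * (1 / 2) ^ m) (picard a H x m) q := by
  have h1 : ∀ n, ∃ y, Tendsto (fun m => (picard a H x m n).1) atTop (𝓝 y) ∧
      ∀ m, ‖(picard a H x m n).1 - y‖ ≤ 4 * (1 / 2) ^ m * (x.re + n / 2) := fun n => by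
    have hu : ∀ m, dist (picard a H x m n).1 (picard a H x (m + 1) n).1 ≤
        2 * (x.re + n / 2) * (1 / 2) ^ m := fun m => by
      rw [dist_eq_norm]
      exact (hb.isClose_picard_succ hx m n).1.trans (by linarith)
    obtain ⟨y, hy⟩ := cauchySeq_tendsto_of_complete
      (cauchySeq_of_le_geometric _ _ (by norm_num) hu)
    refine ⟨y, hy, fun m => ?_⟩
    have := dist_le_of_le_geometric_of_tendsto _ _ (by norm_num) hu hy m
    rw [dist_eq_norm] at this
    exact this.trans_eq (by ring)
  have h2 : ∀ n, ∃ y, Tendsto (fun m => (picard a H x m n).2) atTop (𝓝 y) ∧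
      ∀ m, ‖(picard a H x m n).2 - y‖ ≤ 4 * (1 / 2) ^ m * ((x.re + n / 2) ^ 2)⁻¹ := fun n => by
    have hu : ∀ m, dist (picard a H x m n).2 (picard a H x (m + 1) n).2 ≤
        2 * ((x.re + n / 2) ^ 2)⁻¹ * (1 / 2) ^ m := fun m => by
      rw [dist_eq_norm]
      exact (hb.isClose_picard_succ hx m n).2.trans (by linarith)
    obtain ⟨y, hy⟩ := cauchySeq_tendsto_of_complete
      (cauchySeq_of_le_geometric _ _ (by norm_num) hu)
    refine ⟨y, hy, fun m => ?_⟩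
    have := dist_le_of_le_geometric_of_tendsto _ _ (by norm_num) hu hy m
    rw [dist_eq_norm] at this
    exact this.trans_eq (by ring)
  choose u hu hu' using h1
  choose v hv hv' using h2
  set q : ℕ → ℂ × ℂ := fun n => (u n, v n) with hq
  have hadm : IsAdmissible x.re q := fun n =>
    ⟨ge_of_tendsto' ((Complex.continuous_re.tendsto _).comp (hu n))
      fun m => (hb.isAdmissible_picard hx m n).1,
    le_of_tendsto' (hv n).norm fun m => (hb.isAdmissible_picard hx m n).2⟩
  have hcl : ∀ m, IsClose x.re (4 * (1 / 2) ^ m) (picard a H x m) q :=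
    fun m n => ⟨hu' n m, hv' n m⟩
  refine ⟨q, hadm, ?_, hcl⟩
  have hcl' := fun m => hb.isClose_lyapunovPerron hx (hb.isAdmissible_picard hx m) hadm
    (by positivity) (hcl m)
  have hlim : ∀ c : ℝ, Tendsto (fun m : ℕ => 4 * (1 / 2 : ℝ) ^ m / 2 * c) atTop (𝓝 0) :=
    fun c => by
    simpa using (((tendsto_pow_atTop_nhds_zero_of_lt_one (r := (1 / 2 : ℝ)) (by norm_num)
      (by norm_num)).const_mul 4).div_const 2).mul_const c
  ext n : 1
  refine Prod.ext ?_ ?_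
  · refine tendsto_nhds_unique ?_ ((tendsto_add_atTop_iff_nat 1).2 (hu n))
    rw [tendsto_iff_norm_sub_tendsto_zero]
    exact squeeze_zero (fun _ => norm_nonneg _) (fun m => (hcl' m n).1) (hlim _)
  · refine tendsto_nhds_unique ?_ ((tendsto_add_atTop_iff_nat 1).2 (hv n))
    rw [tendsto_iff_norm_sub_tendsto_zero]
    exact squeeze_zero (fun _ => norm_nonneg _) (fun m => (hcl' m n).2) (hlim _)

lemma apply_succ_of_isFixedPt (hb : PerturbationBounds a H L R) {r : ℝ} (hr : R ≤ r)
    (hp : IsAdmissible r p) (hfp : lyapunovPerron a H x p = p) (n : ℕ) :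
    p (n + 1) = ((p n).1 + 1 + a (p n), (p n).2 + H (p n)) := by
  conv_lhs => rw [← hfp]
  have h1 : (p n).1 = (lyapunovPerron a H x p n).1 := by rw [hfp]
  have h2 : (p n).2 = (lyapunovPerron a H x p n).2 := by rw [hfp]
  refine Prod.ext ?_ ?_
  · simp only [h1, lyapunovPerron, Finset.sum_range_succ]
    push_cast
    ring
  · simp only [h2, lyapunovPerron]
    rw [(hb.summable_H hr hp n).tsum_eq_zero_add]
    simp only [add_zero, neg_add_rev, add_assoc, add_comm 1]
    ring

/-- Together with uniqueness, this makes the graph invariant: the tail of the orbit over `x` solves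
the problem posed at its own starting point. -/
lemma shift_isFixedPt (hb : PerturbationBounds a H L R) (hx : R ≤ x.re)
    (hp : IsAdmissible x.re p) (hfp : lyapunovPerron a H x p = p) :
    IsAdmissible (p 1).1.re (fun n => p (n + 1)) ∧
      lyapunovPerron a H (p 1).1 (fun n => p (n + 1)) = fun n => p (n + 1) := by
  have hR := hb.one_le
  have hx0 : (p 0).1 = x := by rw [← hfp]; simp [lyapunovPerron]
  have hstep := hb.apply_succ_of_isFixedPt hx hp hfp
  have ha : ∀ n, |(a (p n)).re| ≤ 1 / 5 := fun n =>
    (Complex.abs_re_le_norm _).trans (hb.norm_a_comp_le hx hp n)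
  have h1 : (p 1).1.re ≤ x.re + 6 / 5 := by
    rw [hstep 0, hx0]
    simp only [Complex.add_re, Complex.one_re]
    linarith [(abs_le.1 (ha 0)).2]
  constructor
  · intro n
    constructor
    · induction n with
      | zero => simp
      | succ n ih =>
        beta_reduce at ih ⊢
        rw [hstep (n + 1)]
        simp only [Complex.add_re, Complex.one_re]
        push_cast
        linarith [(abs_le.1 (ha (n + 1))).1]
    · have h2 : ‖(p (n + 1)).2‖ ≤ 4 * L * ((x.re + ((n + 1 : ℕ) : ℝ) / 2) ^ 3)⁻¹ := by
        conv_lhs => rw [← hfp]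
        exact hb.norm_snd_lyapunovPerron_le hx hp (n + 1)
      refine h2.trans ?_
      have hρ := le_add_natCast_div_two hx (n + 1)
      -- The real part may grow by up to `6 / 5` in one step while the old box index grows by `1 /
      -- 2`, so the new box is not implied by the old one. The cubic bound on the second component
      -- pays for the factor `2`.
      have h3 : (p 1).1.re + n / 2 ≤ 2 * (x.re + ((n + 1 : ℕ) : ℝ) / 2) := by
        push_cast at hρ ⊢
        have : (0 : ℝ) ≤ n := n.cast_nonneg
        linarith
      have h4 : 0 < (p 1).1.re + n / 2 := by
        have := (hp 1).1
        have : (0 : ℝ) ≤ n := n.cast_nonneg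
        push_cast at *
        linarith
      set ρ := x.re + ((n + 1 : ℕ) : ℝ) / 2
      have h0 : 0 < ρ := by linarith
      calc 4 * L * (ρ ^ 3)⁻¹ = (16 * L / ρ) * ((2 * ρ) ^ 2)⁻¹ := by field_simp; ring
        _ ≤ ((2 * ρ) ^ 2)⁻¹ := by
          refine mul_le_of_le_one_left (by positivity) ?_
          rw [div_le_one h0]
          linarith [hb.mul_le]
        _ ≤ _ := by gcongr
  · ext n : 1
    have h5 : p (n + 1) = lyapunovPerron a H x p (n + 1) := by rw [hfp]
    rw [h5]
    refine Prod.ext ?_ ?_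
    · simp only [lyapunovPerron, Finset.sum_range_succ']
      rw [hstep 0, hx0]
      push_cast
      ring
    · simp only [lyapunovPerron]
      congr 2
      ext k
      congr 2
      ring

lemma differentiableOn_picard (hb : PerturbationBounds a H L R) (m n : ℕ) :
    DifferentiableOn ℂ (fun x => picard a H x m n) {x : ℂ | R < x.re} := by
  have hopen : IsOpen {x : ℂ | R < x.re} := isOpen_lt continuous_const Complex.continuous_re
  have hR := hb.one_le
  induction m generalizing n with
  | zero =>
    simp only [picard]
    fun_prop
  | succ m ih =>
    have hmem : ∀ x : ℂ, R < x.re → ∀ k : ℕ,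
        R < (picard a H x m k).1.re ∧ ‖(picard a H x m k).2‖ < (R ^ 2)⁻¹ := fun x hx k => by
      obtain ⟨h1, h2⟩ := hb.isAdmissible_picard hx.le m k
      have : (0 : ℝ) ≤ k := k.cast_nonneg
      have h3 : R < x.re + k / 2 := by linarith
      refine ⟨h3.trans_le h1, h2.trans_lt ?_⟩
      gcongr
    have hda : ∀ k, DifferentiableOn ℂ (fun x => a (picard a H x m k)) {x : ℂ | R < x.re} :=
      fun k x hx => (hb.differentiableAt_a _ (hmem x hx k).1
        (hmem x hx k).2).comp_differentiableWithinAt x (ih k x hx)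
    have hdH : ∀ k, DifferentiableOn ℂ (fun x => H (picard a H x m k)) {x : ℂ | R < x.re} :=
      fun k x hx => (hb.differentiableAt_H _ (hmem x hx k).1
        (hmem x hx k).2).comp_differentiableWithinAt x (ih k x hx)
    -- Taking `R` instead of `x.re` gives one majorant for the whole half plane.
    obtain ⟨s, -, hs⟩ := hb.exists_hasSum le_rfl n L hb.nonneg
    simp only [picard, lyapunovPerron]
    refine DifferentiableOn.prodMk ?_ (DifferentiableOn.neg ?_)
    · exact (differentiableOn_id.add_const _).add (DifferentiableOn.fun_sum fun k _ => hda k)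
    · refine Complex.differentiableOn_tsum_of_summable_norm hs.summable (fun k => hdH (n + k))
        hopen fun k x hx => ?_
      refine hb.norm_H_le _ (le_add_natCast_div_two le_rfl _) _ ?_
      have hx : R < x.re := hx
      refine box_anti ?_ ?_ (hb.isAdmissible_picard hx.le m (n + k))
      · linarith [le_add_natCast_div_two (le_refl R) (n + k)]
      · linarith

/-- The invariant holomorphic graph over a half plane. -/
theorem exists_invariant_graph (hb : PerturbationBounds a H L R) :
    ∃ Γ : ℂ → ℂ, DifferentiableOn ℂ Γ {x : ℂ | R < x.re} ∧ ∀ x : ℂ, R < x.re →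
      ‖Γ x‖ ≤ 4 * L * (x.re ^ 3)⁻¹ ∧ ‖a (x, Γ x)‖ ≤ 1 / 5 ∧
      Γ (x + 1 + a (x, Γ x)) = Γ x + H (x, Γ x) := by
  have hR := hb.one_le
  have hopen : IsOpen {x : ℂ | R < x.re} := isOpen_lt continuous_const Complex.continuous_re
  have hex : ∀ x : ℂ, ∃ q : ℕ → ℂ × ℂ, R ≤ x.re → IsAdmissible x.re q ∧
      lyapunovPerron a H x q = q ∧
      ∀ m, IsClose x.re (4 * (1 / 2) ^ m) (picard a H x m) q := fun x => by
    by_cases hx : R ≤ x.re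
    · obtain ⟨q, hq⟩ := hb.exists_isFixedPt hx
      exact ⟨q, fun _ => hq⟩
    · exact ⟨fun _ => 0, fun h => absurd h hx⟩
  choose q hq using hex
  refine ⟨fun x => (q x 0).2, ?_, fun x hx => ?_⟩
  · have hlim : Tendsto (fun m : ℕ => 4 * (1 / 2 : ℝ) ^ m) atTop (𝓝 0) := by
      simpa using (tendsto_pow_atTop_nhds_zero_of_lt_one (r := (1 / 2 : ℝ)) (by norm_num)
        (by norm_num)).const_mul 4
    have hunif : TendstoUniformlyOn (fun m x => (picard a H x m 0).2) (fun x => (q x 0).2)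
        atTop {x : ℂ | R < x.re} := by
      rw [Metric.tendstoUniformlyOn_iff]
      intro ε hε
      filter_upwards [hlim.eventually_lt_const hε] with m hm x hx
      have hx : R < x.re := hx
      rw [dist_comm, dist_eq_norm]
      refine lt_of_le_of_lt (((hq x hx.le).2.2 m 0).2.trans ?_) hm
      refine mul_le_of_le_one_right (by positivity) (inv_le_one_of_one_le₀ ?_)
      apply one_le_pow₀
      push_cast
      linarith
    exact hunif.tendstoLocallyUniformlyOn.differentiableOn
      (.of_forall fun m => (hb.differentiableOn_picard m 0).snd) hopen
  · obtain ⟨hadm, hfix, -⟩ := hq x hx.le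
    have hx0 : (q x 0).1 = x := by rw [← hfix]; simp [lyapunovPerron]
    have hpair : (x, (q x 0).2) = q x 0 := Prod.ext hx0.symm rfl
    have hstep := hb.apply_succ_of_isFixedPt hx.le hadm hfix 0
    have ha := hb.norm_a_comp_le hx.le hadm 0
    rw [hpair]
    refine ⟨?_, ha, ?_⟩
    · have := hb.norm_snd_lyapunovPerron_le (x := x) hx.le hadm 0
      rw [hfix] at this
      simpa using this
    · obtain ⟨hadm', hfix'⟩ := hb.shift_isFixedPt hx.le hadm hfix
      have hx1 : x + 1 + a (q x 0) = (q x 1).1 := by rw [hstep, hx0]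
      have hre : R ≤ (q x 1).1.re := by
        have := (hadm 1).1
        push_cast at this
        linarith
      obtain ⟨hadm₁, hfix₁, -⟩ := hq (q x 1).1 hre
      -- The shifted orbit is the one chosen over `x_1`; its initial second component is therefore
      -- the value of the graph there.
      have := hb.eq_of_isFixedPt hre hadm' hadm₁ hfix' hfix₁
      beta_reduce
      rw [hx1, ← this]
      exact congrArg Prod.snd hstep

end PerturbationBounds

/-! ### Lipschitz bounds from size bounds by Cauchy estimates. -/

lemma norm_sub_le_of_norm_le_of_convex {f : ℂ → ℂ} {s : Set ℂ} (hs : Convex ℝ s) {δ M : ℝ}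
    (hδ : 0 < δ)
    (h : ∀ y ∈ s, ∀ u, ‖u - y‖ ≤ δ → DifferentiableAt ℂ f u ∧ ‖f u‖ ≤ M) {x y : ℂ}
    (hx : x ∈ s) (hy : y ∈ s) : ‖f x - f y‖ ≤ M / δ * ‖x - y‖ := by
  refine hs.norm_image_sub_le_of_norm_deriv_le (𝕜 := ℂ) (fun u hu => ?_) (fun u hu => ?_) hy hx
  · exact (h u hu u (by simpa using hδ.le)).1
  · refine Complex.norm_deriv_le_of_forall_mem_sphere_norm_le hδ ?_ fun v hv => ?_
    · have : DifferentiableOn ℂ f (Metric.closedBall u δ) := fun v hv =>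
        (h u hu v (by rwa [← dist_eq_norm])).1.differentiableWithinAt
      exact this.diffContOnCl_ball subset_rfl
    · exact (h u hu v (by rw [← dist_eq_norm]; exact (Metric.mem_sphere.1 hv).le)).2

lemma exists_perturbationBounds {a H : ℂ × ℂ → ℂ} {A r : ℝ} (hA : 0 ≤ A) (hr : 0 < r)
    (h : ∀ p : ℂ × ℂ, r ≤ ‖p.1‖ → ‖p.2‖ ≤ r⁻¹ →
      DifferentiableAt ℂ a p ∧ DifferentiableAt ℂ H p ∧ ‖a p‖ ≤ A * (‖p.1‖⁻¹ + ‖p.2‖) ∧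
        ‖H p‖ ≤ A * ((‖p.1‖ ^ 4)⁻¹ + ‖p.2‖ ^ 2 * ‖p.1‖⁻¹)) :
    ∃ L R, PerturbationBounds a H L R := by
  -- `768 = 16 * 48` gives `16 * L ≤ R` for `L = 48 * A`; the summand `2 * r` keeps the Cauchy discs
  -- inside the domain of the hypotheses.
  set R : ℝ := 1 + 2 * r + 768 * A with hR
  have hdom : ∀ ρ, R ≤ ρ → ∀ p : ℂ × ℂ, ρ / 2 ≤ ‖p.1‖ → ‖p.2‖ ≤ 2 * ρ⁻¹ →
      r ≤ ‖p.1‖ ∧ ‖p.2‖ ≤ r⁻¹ := fun ρ hρ p h1 h2 => by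
    refine ⟨by linarith, h2.trans ?_⟩
    rw [← div_eq_mul_inv, div_le_iff₀ (by linarith), inv_mul_eq_div, le_div_iff₀ hr]
    linarith
  have hdiff : ∀ ρ, R ≤ ρ → ∀ p : ℂ × ℂ, ρ / 2 ≤ ‖p.1‖ → ‖p.2‖ ≤ 2 * ρ⁻¹ →
      DifferentiableAt ℂ a p ∧ DifferentiableAt ℂ H p := fun ρ hρ p h1 h2 => by
    obtain ⟨h3, h4⟩ := hdom ρ hρ p h1 h2
    exact ⟨(h p h3 h4).1, (h p h3 h4).2.1⟩
  have ha : ∀ ρ, R ≤ ρ → ∀ p : ℂ × ℂ, ρ / 2 ≤ ‖p.1‖ → ‖p.2‖ ≤ 2 * ρ⁻¹ →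
      ‖a p‖ ≤ 4 * A * ρ⁻¹ := fun ρ hρ p h1 h2 => by
    obtain ⟨h3, h4⟩ := hdom ρ hρ p h1 h2
    have h0 : 0 < ρ := by linarith
    have h5 : ‖p.1‖⁻¹ ≤ (ρ / 2)⁻¹ := inv_anti₀ (by positivity) h1
    calc ‖a p‖ ≤ A * (‖p.1‖⁻¹ + ‖p.2‖) := (h p h3 h4).2.2.1
      _ ≤ A * ((ρ / 2)⁻¹ + 2 * ρ⁻¹) := by gcongr
      _ = 4 * A * ρ⁻¹ := by field_simp; ring
  have hsq : ∀ ρ, R ≤ ρ → (ρ ^ 2)⁻¹ ≤ ρ⁻¹ := fun ρ hρ => by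
    apply inv_anti₀ <;> nlinarith
  have hH : ∀ ρ, R ≤ ρ → ∀ p : ℂ × ℂ, ρ / 2 ≤ ‖p.1‖ → ‖p.2‖ ≤ 2 * (ρ ^ 2)⁻¹ →
      ‖H p‖ ≤ 24 * A * (ρ ^ 4)⁻¹ := fun ρ hρ p h1 h2 => by
    obtain ⟨h3, h4⟩ := hdom ρ hρ p h1 (by linarith [hsq ρ hρ])
    have h0 : 0 < ρ := by linarith
    have h5 : ‖p.1‖⁻¹ ≤ (ρ / 2)⁻¹ := inv_anti₀ (by positivity) h1
    have h6 : ‖p.1‖⁻¹ ≤ 2 := h5.trans (inv_le_of_inv_le₀ (by positivity) (by linarith))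
    have h7 : (‖p.1‖ ^ 4)⁻¹ ≤ ((ρ / 2) ^ 4)⁻¹ := inv_anti₀ (by positivity) (by gcongr)
    calc ‖H p‖ ≤ A * ((‖p.1‖ ^ 4)⁻¹ + ‖p.2‖ ^ 2 * ‖p.1‖⁻¹) := (h p h3 h4).2.2.2
      _ ≤ A * (((ρ / 2) ^ 4)⁻¹ + (2 * (ρ ^ 2)⁻¹) ^ 2 * 2) := by gcongr
      _ = 24 * A * (ρ ^ 4)⁻¹ := by field_simp; ring
  have hbox : ∀ ρ, R ≤ ρ → ∀ p ∈ box ρ, ρ ≤ ‖p.1‖ ∧ ‖p.2‖ ≤ (ρ ^ 2)⁻¹ := fun ρ hρ p hp =>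
    ⟨hp.1.trans ((le_abs_self _).trans (Complex.abs_re_le_norm _)), hp.2⟩
  have hboxR : ∀ p : ℂ × ℂ, R < p.1.re → ‖p.2‖ < (R ^ 2)⁻¹ →
      R / 2 ≤ ‖p.1‖ ∧ ‖p.2‖ ≤ 2 * R⁻¹ := fun p h1 h2 => by
    obtain ⟨h3, h4⟩ := hbox R le_rfl p ⟨h1.le, h2.le⟩
    have := hsq R le_rfl
    have : 0 ≤ R⁻¹ := by positivity
    exact ⟨by linarith, by linarith⟩
  have hcvx : ∀ ρ : ℝ, Convex ℝ {u : ℂ | ρ ≤ u.re} := fun ρ => convex_halfSpace_re_ge ρ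
  have hshift : ∀ {ρ : ℝ} {y u : ℂ}, ρ ≤ y.re → ‖u - y‖ ≤ ρ / 2 → ρ / 2 ≤ ‖u‖ :=
    fun {ρ y u} h1 h2 => by
      have h3 := (Complex.re_le_norm y)
      have h4 := norm_sub_norm_le y u
      rw [norm_sub_rev] at h4
      linarith
  refine ⟨48 * A, R, ⟨by linarith, by positivity, by linarith,
    fun p h1 h2 => (hdiff R le_rfl p (hboxR p h1 h2).1 (hboxR p h1 h2).2).1,
    fun p h1 h2 => (hdiff R le_rfl p (hboxR p h1 h2).1 (hboxR p h1 h2).2).2, fun p hp => ?_,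
    fun ρ hρ p hp => ?_, fun ρ hρ p hp q hq => ?_, fun ρ hρ p hp q hq => ?_⟩⟩
  · obtain ⟨h1, h2⟩ := hbox R le_rfl p hp
    have := hsq R le_rfl
    have h0 : 0 < R := by linarith
    have : 0 ≤ R⁻¹ := by positivity
    refine (ha R le_rfl p (by linarith) (by linarith)).trans ?_
    rw [← div_eq_mul_inv, div_le_iff₀ h0]
    linarith
  · obtain ⟨h1, h2⟩ := hbox ρ hρ p hp
    have h0 : 0 ≤ (ρ ^ 2)⁻¹ := by positivity
    refine (hH ρ hρ p (by linarith) (by linarith)).trans ?_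
    gcongr
    norm_num
  · obtain ⟨h1, h2⟩ := hbox ρ hρ p hp
    obtain ⟨h3, h4⟩ := hbox ρ hρ q hq
    have h5 := hsq ρ hρ
    have h0 : 0 < ρ := by linarith
    have h6 : 0 < ρ⁻¹ := by positivity
    have e1 : ‖a (p.1, p.2) - a (q.1, p.2)‖ ≤ 4 * A * ρ⁻¹ / (ρ / 2) * ‖p.1 - q.1‖ :=
      norm_sub_le_of_norm_le_of_convex (f := fun u => a (u, p.2)) (hcvx ρ) (by positivity)
        (fun y hy u hu => by
          have h7 := hshift hy hu
          have h8 : ‖p.2‖ ≤ 2 * ρ⁻¹ := by linarith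
          exact ⟨(hdiff ρ hρ (u, p.2) h7 h8).1.comp u (by fun_prop), ha ρ hρ (u, p.2) h7 h8⟩)
        hp.1 hq.1
    -- Discs in `w` have radius `ρ⁻¹` for `a`, making its Lipschitz constant `O(1)`. For `H` below
    -- the radius is `ρ⁻²`, since its `ρ⁻⁴` bound needs `w = O(ρ⁻²)`.
    have e2 : ‖a (q.1, p.2) - a (q.1, q.2)‖ ≤ 4 * A * ρ⁻¹ / ρ⁻¹ * ‖p.2 - q.2‖ :=
      norm_sub_le_of_norm_le_of_convex (f := fun u => a (q.1, u))
        (convex_closedBall 0 (ρ ^ 2)⁻¹) (by positivity)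
        (fun y hy u hu => by
          have h7 : ρ / 2 ≤ ‖q.1‖ := by linarith
          have h8 : ‖u‖ ≤ 2 * ρ⁻¹ := by
            rw [mem_closedBall_zero_iff] at hy
            have := norm_sub_norm_le u y
            linarith
          exact ⟨(hdiff ρ hρ (q.1, u) h7 h8).1.comp u (by fun_prop), ha ρ hρ (q.1, u) h7 h8⟩)
        (by simpa using h2) (by simpa using h4)
    calc ‖a p - a q‖ ≤ ‖a (p.1, p.2) - a (q.1, p.2)‖ + ‖a (q.1, p.2) - a (q.1, q.2)‖ :=
          norm_sub_le_norm_sub_add_norm_sub _ _ _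
      _ ≤ 4 * A * ρ⁻¹ / (ρ / 2) * ‖p.1 - q.1‖ + 4 * A * ρ⁻¹ / ρ⁻¹ * ‖p.2 - q.2‖ :=
          add_le_add e1 e2
      _ = 8 * A * (ρ ^ 2)⁻¹ * ‖p.1 - q.1‖ + 4 * A * ‖p.2 - q.2‖ := by field_simp; ring
      _ ≤ 48 * A * (ρ ^ 2)⁻¹ * ‖p.1 - q.1‖ + 48 * A * ‖p.2 - q.2‖ := by gcongr <;> norm_num
      _ = _ := by ring
  · obtain ⟨h1, h2⟩ := hbox ρ hρ p hp
    obtain ⟨h3, h4⟩ := hbox ρ hρ q hq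
    have h5 := hsq ρ hρ
    have h0 : 0 < ρ := by linarith
    have h6 : 0 < (ρ ^ 2)⁻¹ := by positivity
    have e1 : ‖H (p.1, p.2) - H (q.1, p.2)‖ ≤ 24 * A * (ρ ^ 4)⁻¹ / (ρ / 2) * ‖p.1 - q.1‖ :=
      norm_sub_le_of_norm_le_of_convex (f := fun u => H (u, p.2)) (hcvx ρ) (by positivity)
        (fun y hy u hu => by
          have h7 := hshift hy hu
          have h8 : ‖p.2‖ ≤ 2 * (ρ ^ 2)⁻¹ := by linarith
          exact ⟨(hdiff ρ hρ (u, p.2) h7 (by linarith)).2.comp u (by fun_prop),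
            hH ρ hρ (u, p.2) h7 h8⟩)
        hp.1 hq.1
    have e2 : ‖H (q.1, p.2) - H (q.1, q.2)‖ ≤
        24 * A * (ρ ^ 4)⁻¹ / (ρ ^ 2)⁻¹ * ‖p.2 - q.2‖ :=
      norm_sub_le_of_norm_le_of_convex (f := fun u => H (q.1, u))
        (convex_closedBall 0 (ρ ^ 2)⁻¹) (by positivity)
        (fun y hy u hu => by
          have h7 : ρ / 2 ≤ ‖q.1‖ := by linarith
          have h8 : ‖u‖ ≤ 2 * (ρ ^ 2)⁻¹ := by
            rw [mem_closedBall_zero_iff] at hy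
            have := norm_sub_norm_le u y
            linarith
          exact ⟨(hdiff ρ hρ (q.1, u) h7 (by linarith)).2.comp u (by fun_prop),
            hH ρ hρ (q.1, u) h7 h8⟩)
        (by simpa using h2) (by simpa using h4)
    calc ‖H p - H q‖ ≤ ‖H (p.1, p.2) - H (q.1, p.2)‖ + ‖H (q.1, p.2) - H (q.1, q.2)‖ :=
          norm_sub_le_norm_sub_add_norm_sub _ _ _
      _ ≤ 24 * A * (ρ ^ 4)⁻¹ / (ρ / 2) * ‖p.1 - q.1‖ +
            24 * A * (ρ ^ 4)⁻¹ / (ρ ^ 2)⁻¹ * ‖p.2 - q.2‖ := add_le_add e1 e2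
      _ = 48 * A * (ρ ^ 5)⁻¹ * ‖p.1 - q.1‖ + 24 * A * (ρ ^ 2)⁻¹ * ‖p.2 - q.2‖ := by
          field_simp; ring
      _ ≤ 48 * A * (ρ ^ 5)⁻¹ * ‖p.1 - q.1‖ + 48 * A * (ρ ^ 2)⁻¹ * ‖p.2 - q.2‖ := by
          gcongr; norm_num
      _ = _ := by ring

/-! ### The map `F` in the coordinate `x = -1 / z`. -/

/-- The perturbation of the translation in the first component of `F`, in the coordinate
`x = -1 / z`. -/
def fstPerturbation (F : ℂ × ℂ → ℂ × ℂ) (p : ℂ × ℂ) : ℂ := -(F (-p.1⁻¹, p.2)).1⁻¹ - p.1 - 1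

/-- The increment of the second component under `F`, in the coordinate `x = -1 / z`. -/
def sndPerturbation (F : ℂ × ℂ → ℂ × ℂ) (p : ℂ × ℂ) : ℂ := (F (-p.1⁻¹, p.2)).2 - p.2

/-- With `y = z (1 + z + e)`, the term `z²` produces exactly the translation by `1`; the remainder
is `(e - z (z + e)) / (z (1 + z + e))`. -/
lemma fst_estimate {z w y : ℂ} {K : ℝ} (hK : 0 ≤ K) (hz0 : z ≠ 0) (hz : ‖z‖ ≤ 1 / 4)
    (hKz : K * ‖z‖ ≤ 1 / 2) (hKw : K * ‖w‖ ≤ 1 / 2)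
    (hy : ‖y - (z + z ^ 2)‖ ≤ K * (‖z‖ ^ 3 + ‖z‖ ^ 2 * ‖w‖)) :
    y ≠ 0 ∧ ‖-y⁻¹ + z⁻¹ - 1‖ ≤ (2 * K + 4) * (‖z‖ + ‖w‖) := by
  have hzpos : 0 < ‖z‖ := norm_pos_iff.2 hz0
  set e : ℂ := (y - (z + z ^ 2)) / z with he
  have hye : y = z * (1 + (z + e)) := by rw [he]; field_simp; ring
  have hen : ‖e‖ ≤ K * ‖z‖ * (‖z‖ + ‖w‖) := by
    rw [he, norm_div, div_le_iff₀ hzpos]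
    exact hy.trans_eq (by ring)
  have hs : ‖z + e‖ ≤ 2 * ‖z‖ := by
    refine (norm_add_le _ _).trans ?_
    nlinarith
  have h1 : 1 / 2 ≤ ‖1 + (z + e)‖ := by
    have := norm_sub_le_norm_add (1 : ℂ) (z + e)
    rw [norm_one] at this
    linarith
  have h1' : 1 + (z + e) ≠ 0 := norm_pos_iff.1 (by linarith)
  refine ⟨by rw [hye]; exact mul_ne_zero hz0 h1', ?_⟩
  have e2 : -y⁻¹ + z⁻¹ - 1 = (e - z * (z + e)) / (z * (1 + (z + e))) := by
    rw [hye]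
    field_simp
    ring
  rw [e2, norm_div, norm_mul, div_le_iff₀ (by positivity)]
  calc ‖e - z * (z + e)‖ ≤ ‖e‖ + ‖z * (z + e)‖ := norm_sub_le _ _
    _ ≤ K * ‖z‖ * (‖z‖ + ‖w‖) + ‖z‖ * (2 * ‖z‖) := by
      rw [norm_mul]
      gcongr
    _ ≤ (2 * K + 4) * (‖z‖ + ‖w‖) * (‖z‖ * (1 / 2)) := by
      nlinarith [mul_nonneg hzpos.le (norm_nonneg w)]
    _ ≤ _ := by gcongr

lemma snd_estimate {z w y : ℂ} {K : ℝ} (hK : 0 ≤ K) (hz : ‖z‖ ≤ 1) (hw : ‖w‖ ≤ 1)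
    (hy : ‖y - (w - w ^ 2 * z - z ^ 4 / 3 + 8 * z ^ 3 * w / 3)‖ ≤
      K * (‖z‖ ^ 5 + ‖z‖ ^ 4 * ‖w‖ + ‖z‖ ^ 2 * ‖w‖ ^ 2 + ‖z‖ * ‖w‖ ^ 3)) :
    ‖y - w‖ ≤ (4 + 4 * K) * (‖z‖ ^ 4 + ‖w‖ ^ 2 * ‖z‖) := by
  set Z := ‖z‖ with hZ
  set W := ‖w‖ with hW
  have hZ0 : 0 ≤ Z := norm_nonneg _
  have hW0 : 0 ≤ W := norm_nonneg _
  have h1 : ‖-(w ^ 2 * z) - z ^ 4 / 3 + 8 * z ^ 3 * w / 3‖ ≤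
      W ^ 2 * Z + Z ^ 4 / 3 + 8 * Z ^ 3 * W / 3 := by
    refine (norm_add_le _ _).trans (add_le_add ((norm_sub_le _ _).trans ?_) ?_) <;>
      simp [hZ, hW]
  have h2 : y - w = (y - (w - w ^ 2 * z - z ^ 4 / 3 + 8 * z ^ 3 * w / 3)) +
      (-(w ^ 2 * z) - z ^ 4 / 3 + 8 * z ^ 3 * w / 3) := by ring
  rw [h2]
  refine (norm_add_le _ _).trans ((add_le_add hy h1).trans ?_)
  have a1 : Z ^ 5 ≤ Z ^ 4 := pow_le_pow_of_le_one hZ0 hz (by norm_num)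
  have a2 : Z ^ 4 * W ≤ Z ^ 4 := mul_le_of_le_one_right (by positivity) hw
  have a3 : Z ^ 2 * W ^ 2 ≤ W ^ 2 * Z := by
    have : Z ^ 2 ≤ Z := by nlinarith
    nlinarith [sq_nonneg W]
  have a4 : Z * W ^ 3 ≤ W ^ 2 * Z := by
    have : W ^ 3 ≤ W ^ 2 := pow_le_pow_of_le_one hW0 hw (by norm_num)
    nlinarith
  -- Expanding `Z (Z² - W)² ≥ 0` bounds the cross term by `Z⁵ + Z W²`.
  have a5 : Z ^ 3 * W ≤ Z ^ 4 + W ^ 2 * Z := by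
    have : 0 ≤ Z * (Z ^ 2 - W) ^ 2 := by positivity
    have : 0 ≤ Z * W ^ 2 := by positivity
    have : 0 ≤ Z ^ 5 := by positivity
    nlinarith
  have a6 : 0 ≤ W ^ 2 * Z := by positivity
  have a7 : 0 ≤ Z ^ 4 := by positivity
  have a8 : K * (Z ^ 5 + Z ^ 4 * W + Z ^ 2 * W ^ 2 + Z * W ^ 3) ≤
      K * (4 * (Z ^ 4 + W ^ 2 * Z)) := by
    apply mul_le_mul_of_nonneg_left _ hK
    linarith
  linarith

lemma IsSpecialAutomorphism.exists_local_bounds {F : ℂ × ℂ → ℂ × ℂ}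
    (hF : IsSpecialAutomorphism F) :
    ∃ A r : ℝ, 0 ≤ A ∧ 0 < r ∧ ∀ p : ℂ × ℂ, r ≤ ‖p.1‖ → ‖p.2‖ ≤ r⁻¹ →
      (F (-p.1⁻¹, p.2)).1 ≠ 0 ∧
      ‖fstPerturbation F p‖ ≤ A * (‖p.1‖⁻¹ + ‖p.2‖) ∧
      ‖sndPerturbation F p‖ ≤ A * ((‖p.1‖ ^ 4)⁻¹ + ‖p.2‖ ^ 2 * ‖p.1‖⁻¹) := by
  obtain ⟨K₁, hK₁, h1⟩ := hF.fst_expansion.exists_pos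
  obtain ⟨K₂, hK₂, h2⟩ := hF.snd_expansion.exists_pos
  obtain ⟨δ, hδ, hball⟩ := Metric.eventually_nhds_iff.1 (h1.bound.and h2.bound)
  set r : ℝ := 4 + 2 * K₁ + 2 * δ⁻¹ with hr
  have hδ' : 0 < δ⁻¹ := by positivity
  have hr0 : 0 < r := by positivity
  refine ⟨(2 * K₁ + 4) + (4 + 4 * K₂), r, by positivity, hr0, fun p hp1 hp2 => ?_⟩
  obtain ⟨x, w⟩ := p
  dsimp only at hp1 hp2
  have hx0 : x ≠ 0 := norm_pos_iff.1 (hr0.trans_le hp1)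
  set z : ℂ := -x⁻¹ with hz
  have hzx : ‖z‖ = ‖x‖⁻¹ := by simp [hz]
  have hz0 : z ≠ 0 := by simp [hz, hx0]
  have hzr : ‖z‖ ≤ r⁻¹ := by rw [hzx]; exact inv_anti₀ hr0 hp1
  have hr4 : r⁻¹ ≤ 1 / 4 := by
    rw [one_div]
    exact inv_anti₀ (by norm_num) (by linarith)
  have hrK : K₁ * r⁻¹ ≤ 1 / 2 := by
    rw [← div_eq_mul_inv, div_le_iff₀ hr0]
    linarith
  have hrδ : r⁻¹ < δ := inv_lt_of_inv_lt₀ hδ (by linarith)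
  have hmem : dist (z, w) 0 < δ := by
    rw [dist_zero_right]
    exact max_lt (hzr.trans_lt hrδ) (hp2.trans_lt hrδ)
  obtain ⟨b1, b2⟩ := hball hmem
  dsimp only at b1 b2
  rw [Real.norm_of_nonneg (by positivity)] at b1 b2
  simp only [norm_mul, norm_pow] at b1 b2
  obtain ⟨c1, c2⟩ := fst_estimate hK₁.le hz0 (hzr.trans hr4)
    ((mul_le_mul_of_nonneg_left hzr hK₁.le).trans hrK)
    ((mul_le_mul_of_nonneg_left hp2 hK₁.le).trans hrK) b1
  have c3 := snd_estimate hK₂.le (by linarith) (by linarith) b2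
  have hxz : x = -z⁻¹ := by simp [hz]
  refine ⟨c1, ?_, ?_⟩
  · have e : fstPerturbation F (x, w) = -(F (z, w)).1⁻¹ + z⁻¹ - 1 := by
      simp only [fstPerturbation, ← hz]
      linear_combination (-1) * hxz
    rw [e, ← hzx]
    exact c2.trans (mul_le_mul_of_nonneg_right (by linarith) (by positivity))
  · have e : (‖x‖ ^ 4)⁻¹ = ‖z‖ ^ 4 := by rw [hzx, inv_pow]
    rw [e, ← hzx]
    exact c3.trans (mul_le_mul_of_nonneg_right (by linarith) (by positivity))

/-! ### The invariant graph over a cone in the coordinate `z`. -/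

/-- The cone `|z| < -4 Re z`, truncated at radius `δ`. -/
def truncatedCone (δ : ℝ) : Set ℂ := {z | ‖z‖ < δ ∧ ‖z‖ < 4 * -z.re}

lemma isOpen_truncatedCone (δ : ℝ) : IsOpen (truncatedCone δ) :=
  (isOpen_lt continuous_norm continuous_const).inter
    (isOpen_lt continuous_norm (by fun_prop))

lemma ne_zero_of_mem_truncatedCone {δ : ℝ} {z : ℂ} (hz : z ∈ truncatedCone δ) : z ≠ 0 := by
  rintro rfl
  simpa using hz.2

lemma lt_re_neg_inv_of_mem_truncatedCone {δ : ℝ} {z : ℂ} (hz : z ∈ truncatedCone δ) :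
    (4 * ‖z‖)⁻¹ < (-z⁻¹).re := by
  have hz0 : 0 < ‖z‖ := norm_pos_iff.2 (ne_zero_of_mem_truncatedCone hz)
  have h := hz.2
  rw [Complex.neg_re, Complex.inv_re, Complex.normSq_eq_norm_sq, ← neg_div,
    lt_div_iff₀ (by positivity)]
  have : (4 * ‖z‖)⁻¹ * ‖z‖ ^ 2 = ‖z‖ / 4 := by field_simp
  linarith

/-- The invariant graph of `F` over a truncated cone; the first component acts there as
`-1 / z ↦ -1 / z + 1 + α` with `α` small. -/
theorem IsSpecialAutomorphism.exists_invariant_graph {F : ℂ × ℂ → ℂ × ℂ}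
    (hF : IsSpecialAutomorphism F) :
    ∃ (δ C : ℝ) (γ : ℂ → ℂ), 0 < δ ∧ 0 < C ∧ γ 0 = 0 ∧
      DifferentiableOn ℂ γ (truncatedCone δ) ∧ ∀ z ∈ truncatedCone δ,
        ‖γ z‖ ≤ C * ‖z‖ ^ 3 ∧ ∃ α : ℂ, ‖α‖ ≤ 1 / 5 ∧
          F (z, γ z) = (-(-z⁻¹ + 1 + α)⁻¹, γ (-(-z⁻¹ + 1 + α)⁻¹)) := by
  obtain ⟨A, r, hA, hr, hloc⟩ := hF.exists_local_bounds
  have hd : Differentiable ℂ F := hF.isAutomorphism.1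
  obtain ⟨L, R, hb⟩ : ∃ L R, PerturbationBounds (fstPerturbation F) (sndPerturbation F) L R := by
    refine exists_perturbationBounds hA hr fun p hp1 hp2 => ?_
    obtain ⟨h1, h2, h3⟩ := hloc p hp1 hp2
    have hp0 : p.1 ≠ 0 := norm_pos_iff.1 (hr.trans_le hp1)
    have hd1 : DifferentiableAt ℂ (fun q : ℂ × ℂ => F (-q.1⁻¹, q.2)) p :=
      (hd _).comp p (f := fun q : ℂ × ℂ => (-q.1⁻¹, q.2))
        ((differentiableAt_fst.inv hp0).neg.prodMk differentiableAt_snd)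
    exact ⟨((hd1.fst.inv h1).neg.sub differentiableAt_fst).sub_const 1,
      hd1.snd.sub differentiableAt_snd, h2, h3⟩
  obtain ⟨Γ, hΓd, hΓ⟩ := hb.exists_invariant_graph
  have hR := hb.one_le
  have hL := hb.nonneg
  set δ : ℝ := (4 * (R + r))⁻¹ with hδ
  have hre : ∀ z ∈ truncatedCone δ, R + r < (-z⁻¹).re := fun z hz => by
    refine lt_trans ?_ (lt_re_neg_inv_of_mem_truncatedCone hz)
    have hz0 : 0 < ‖z‖ := norm_pos_iff.2 (ne_zero_of_mem_truncatedCone hz)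
    have h1 : ‖z‖ < (4 * (R + r))⁻¹ := hz.1
    rw [lt_inv_comm₀ (by positivity) (by positivity)]
    rw [mul_inv] at h1
    linarith
  -- `256 * L` is `4 * L * 4³`, from `Re x > 1 / (4 |z|)`; adding `1` makes the constant positive
  -- even if `L = 0`.
  refine ⟨δ, 256 * L + 1, fun z => if z = 0 then 0 else Γ (-z⁻¹), by positivity, by positivity,
    if_pos rfl, ?_, fun z hz => ?_⟩
  · have h1 : DifferentiableOn ℂ (fun z => Γ (-z⁻¹)) (truncatedCone δ) := by
      refine hΓd.comp (fun z hz => ?_) fun z hz => ?_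
      · exact (differentiableAt_inv
          (ne_zero_of_mem_truncatedCone hz)).neg.differentiableWithinAt
      · exact lt_trans (by linarith) (hre z hz)
    exact h1.congr fun z hz => if_neg (ne_zero_of_mem_truncatedCone hz)
  · have hz0 := ne_zero_of_mem_truncatedCone hz
    have hzpos : 0 < ‖z‖ := norm_pos_iff.2 hz0
    have hx := hre z hz
    have hlt := lt_re_neg_inv_of_mem_truncatedCone hz
    simp only [if_neg hz0]
    set x : ℂ := -z⁻¹ with hxz
    obtain ⟨h1, h2, h3⟩ := hΓ x (by linarith)
    have hxpos : 0 < x.re := by linarith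
    refine ⟨?_, fstPerturbation F (x, Γ x), h2, ?_⟩
    · have h4 : (x.re ^ 3)⁻¹ ≤ ((4 * ‖z‖)⁻¹ ^ 3)⁻¹ := inv_anti₀ (by positivity) (by gcongr)
      calc ‖Γ x‖ ≤ 4 * L * ((4 * ‖z‖)⁻¹ ^ 3)⁻¹ := h1.trans (by gcongr)
        _ = 256 * L * ‖z‖ ^ 3 := by rw [inv_pow, inv_inv]; ring
        _ ≤ (256 * L + 1) * ‖z‖ ^ 3 := by gcongr; linarith
    · have h4 : r ≤ ‖x‖ := by linarith [Complex.re_le_norm x]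
      have h5 : ‖Γ x‖ ≤ r⁻¹ := by
        refine h1.trans ?_
        rw [← div_eq_mul_inv, div_le_iff₀ (by positivity), inv_mul_eq_div, le_div_iff₀ hr]
        have h6 : 4 * L ≤ x.re := by linarith [hb.mul_le]
        have h7 : r ≤ x.re := by linarith
        have h8 : 1 ≤ x.re := by linarith
        calc 4 * L * r ≤ x.re * x.re := by gcongr
          _ ≤ x.re * x.re * x.re := le_mul_of_one_le_right (by positivity) h8
          _ = x.re ^ 3 := by ring
      have hne := (hloc (x, Γ x) h4 h5).1
      have hzx : -x⁻¹ = z := by simp [hxz]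
      simp only [hzx] at hne
      have hstep : x + 1 + fstPerturbation F (x, Γ x) = -(F (z, Γ x)).1⁻¹ := by
        simp only [fstPerturbation, hzx]
        ring
      have hsnd : Γ x + sndPerturbation F (x, Γ x) = (F (z, Γ x)).2 := by
        simp only [sndPerturbation, hzx]
        ring
      rw [hsnd, hstep] at h3
      rw [hstep]
      -- The first component of the image is nonzero, so the value of the new function there is that
      -- of `Γ`, not the default at `0`.
      simp only [inv_neg, neg_neg, inv_inv, if_neg hne, h3]

/-! ### The characteristic direction. -/

/-- The Cauchy estimate on a circle of radius `R` gives `2 K R`, which tends to `0`. -/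
lemma iteratedDeriv_two_eq_zero_of_isBigO {E : Type*} [NormedAddCommGroup E] [NormedSpace ℂ E]
    [CompleteSpace E] {g : ℂ → E} (hg : Differentiable ℂ g)
    (hO : g =O[𝓝 0] fun t : ℂ => t ^ 3) : iteratedDeriv 2 g 0 = 0 := by
  obtain ⟨K, hK, hb⟩ := hO.exists_pos
  obtain ⟨δ, hδ, hball⟩ := Metric.eventually_nhds_iff.1 hb.bound
  rw [← norm_le_zero_iff]
  have hlim : Tendsto (fun R : ℝ => 2 * K * R) (𝓝[>] 0) (𝓝 0) := by
    have : Tendsto (fun R : ℝ => 2 * K * R) (𝓝 0) (𝓝 (2 * K * 0)) :=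
      (continuous_const.mul continuous_id).tendsto 0
    rw [mul_zero] at this
    exact this.mono_left nhdsWithin_le_nhds
  refine ge_of_tendsto hlim ?_
  filter_upwards [Ioo_mem_nhdsGT hδ] with R hR
  have h := Complex.norm_iteratedDeriv_le_of_forall_mem_sphere_norm_le (c := 0) (C := K * R ^ 3)
    2 hR.1 hg.diffContOnCl fun z hz => by
      have hz : ‖z‖ = R := by simpa using hz
      have := hball (y := z) (by rw [dist_zero_right, hz]; exact hR.2)
      rwa [norm_pow, hz] at this
  refine h.trans_eq ?_
  have := hR.1.ne'
  field_simp
  norm_num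

lemma IsSpecialAutomorphism.homogeneousPart_two {F : ℂ × ℂ → ℂ × ℂ}
    (hF : IsSpecialAutomorphism F) : homogeneousPart F 2 (1, 0) = (1, 0) := by
  have hd : Differentiable ℂ F := hF.isAutomorphism.1
  have hdF : Differentiable ℂ fun t : ℂ => F (t • ((1, 0) : ℂ × ℂ)) :=
    hd.comp (differentiable_id.smul_const _)
  have hdq : Differentiable ℂ fun t : ℂ => (t + t ^ 2) • ((1, 0) : ℂ × ℂ) :=
    (differentiable_id.add (differentiable_id.pow 2)).smul_const _
  have htend : Tendsto (fun t : ℂ => t • ((1, 0) : ℂ × ℂ)) (𝓝 0) (𝓝 0) := by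
    have : Continuous fun t : ℂ => t • ((1, 0) : ℂ × ℂ) := by fun_prop
    simpa using this.tendsto 0
  have hO : (fun t : ℂ => F (t • ((1, 0) : ℂ × ℂ)) - (t + t ^ 2) • ((1, 0) : ℂ × ℂ)) =O[𝓝 0]
      fun t : ℂ => t ^ 3 := by
    have hpow : ∀ n : ℕ, 3 ≤ n → (fun t : ℂ => t ^ n) =O[𝓝 0] fun t : ℂ => t ^ 3 := fun n hn => by
      refine IsBigO.of_bound 1 ?_
      filter_upwards [Metric.ball_mem_nhds (0 : ℂ) one_pos] with t ht
      rw [one_mul, norm_pow, norm_pow]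
      exact pow_le_pow_of_le_one (norm_nonneg _) (mem_ball_zero_iff.1 ht).le hn
    refine IsBigO.prod_left ?_ ?_
    · have h1 := hF.fst_expansion.comp_tendsto htend
      simp only [Function.comp_def, Prod.smul_mk, smul_eq_mul, mul_one, mul_zero, norm_zero,
        add_zero] at h1
      simpa using h1.trans (hpow 3 le_rfl).norm_left
    · have h1 := hF.snd_expansion.comp_tendsto htend
      simp only [Function.comp_def, Prod.smul_mk, smul_eq_mul, mul_one, mul_zero, norm_zero,
        add_zero, ne_eq, OfNat.ofNat_ne_zero, not_false_eq_true, zero_pow, zero_mul, sub_zero,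
        zero_div] at h1
      have h2 := (h1.trans ((hpow 5 (by norm_num)).norm_left)).sub
        ((hpow 4 (by norm_num)).const_mul_left (1 / 3))
      refine h2.congr_left fun t => ?_
      simp only [Prod.smul_mk, smul_eq_mul, mul_one, mul_zero]
      ring
  have h0 := iteratedDeriv_two_eq_zero_of_isBigO (hdF.sub hdq) hO
  rw [iteratedDeriv_sub hdF.contDiff.contDiffAt hdq.contDiff.contDiffAt, sub_eq_zero] at h0
  have hq : iteratedDeriv 2 (fun t : ℂ => (t + t ^ 2) • ((1, 0) : ℂ × ℂ)) 0 = (2, 0) := by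
    have h1 : deriv (fun t : ℂ => (t + t ^ 2) • ((1, 0) : ℂ × ℂ)) =
        fun t => (1 + 2 * t) • ((1, 0) : ℂ × ℂ) := by
      ext t : 1
      have := (((hasDerivAt_id t).add ((hasDerivAt_id t).pow 2)).smul_const ((1, 0) : ℂ × ℂ)).deriv
      simpa using this
    have h2 : HasDerivAt (fun t : ℂ => (1 + 2 * t) • ((1, 0) : ℂ × ℂ)) ((2 : ℂ) • (1, 0)) 0 := by
      have := (((hasDerivAt_id (0 : ℂ)).const_mul 2).const_add 1).smul_const ((1, 0) : ℂ × ℂ)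
      simpa using this
    rw [iteratedDeriv_succ, iteratedDeriv_one, h1, h2.deriv]
    simp
  rw [homogeneousPart, h0, hq]
  simp

lemma IsSpecialAutomorphism.isNondegenerateCharacteristicDirection {F : ℂ × ℂ → ℂ × ℂ}
    (hF : IsSpecialAutomorphism F) : IsNondegenerateCharacteristicDirection F (1, 0) := by
  have h := hF.homogeneousPart_two
  refine ⟨by simp, 2, le_rfl, fun h h1 h2 => absurd h1 (by omega), ⟨(1, 0), ?_⟩, 1,
    one_ne_zero, ?_⟩
  · rw [h]
    simp
  · rw [h, one_smul]

/-! ### Geometry and invariance of the sector. -/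

lemma tan_pi_div_eight_gt : 1 / 4 < Real.tan (Real.pi / 8) := by
  have h1 := Real.lt_tan (x := Real.pi / 8) (by positivity) (by linarith [Real.pi_pos])
  linarith [Real.pi_gt_three]

lemma tan_pi_div_eight_lt : Real.tan (Real.pi / 8) < 1 := by
  rw [← Real.tan_pi_div_four]
  have := Real.pi_pos
  exact Real.tan_lt_tan_of_lt_of_lt_pi_div_two (by linarith) (by linarith) (by linarith)

/-- Replacing the argument by a slope makes openness, convexity and invariance matters of linear
inequalities. The strict slope bound already excludes `0`. -/
lemma mem_sector_iff {ε : ℝ} {z : ℂ} :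
    z ∈ sector ε ↔ ‖z‖ < ε ∧ |z.im| < Real.tan (Real.pi / 8) * -z.re := by
  have hpi := Real.pi_pos
  have hτ := tan_pi_div_eight_gt
  have key : ∀ u : ℂ, 0 < u.re →
      (|Complex.arg u| < Real.pi / 8 ↔ |u.im| < Real.tan (Real.pi / 8) * u.re) := fun u hu => by
    have h1 : |Complex.arg u| < Real.pi / 2 := Complex.abs_arg_lt_pi_div_two_iff.2 (.inl hu)
    have h2 := abs_lt.1 h1
    rw [abs_lt, abs_lt, ← div_lt_iff₀ hu, ← neg_mul, ← lt_div_iff₀ hu, ← Complex.tan_arg,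
      ← Real.tan_neg]
    rw [Real.strictMonoOn_tan.lt_iff_lt ⟨by linarith, by linarith⟩ h2,
      Real.strictMonoOn_tan.lt_iff_lt h2 ⟨by linarith, by linarith⟩]
  constructor
  · rintro ⟨h1, h2, h3⟩
    have hz : -z ≠ 0 := by simpa using h1
    have h4 : 0 < (-z).re :=
      (Complex.abs_arg_lt_pi_div_two_iff.1 (h3.trans (by linarith))).resolve_right hz
    have h5 := (key _ h4).1 h3
    exact ⟨h2, by simpa using h5⟩
  · rintro ⟨h1, h2⟩
    have h4 : 0 < (-z).re := by
      have := (abs_nonneg _).trans_lt h2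
      simpa using pos_of_mul_pos_right this (by linarith)
    refine ⟨?_, h1, (key _ h4).2 (by simpa using h2)⟩
    rw [norm_pos_iff]
    rintro rfl
    simp at h4

lemma isOpen_sector (ε : ℝ) : IsOpen (sector ε) := by
  have : sector ε = {z : ℂ | ‖z‖ < ε ∧ |z.im| < Real.tan (Real.pi / 8) * -z.re} := by
    ext z
    exact mem_sector_iff
  rw [this, Set.ofPred_and]
  exact (isOpen_lt (by fun_prop) (by fun_prop)).inter (isOpen_lt (by fun_prop) (by fun_prop))

lemma convex_sector (ε : ℝ) : Convex ℝ (sector ε) := by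
  have hτ := tan_pi_div_eight_gt
  intro z hz w hw a b ha hb hab
  rw [mem_sector_iff] at *
  constructor
  · have := convex_ball (0 : ℂ) ε (mem_ball_zero_iff.2 hz.1) (mem_ball_zero_iff.2 hw.1) ha hb hab
    simpa using this
  · obtain ⟨h1, h2⟩ := abs_lt.1 hz.2
    obtain ⟨h3, h4⟩ := abs_lt.1 hw.2
    simp only [Complex.add_im, Complex.add_re, Complex.smul_re, Complex.smul_im, smul_eq_mul]
    rcases ha.eq_or_lt with rfl | ha'
    · obtain rfl : b = 1 := by linarith
      simpa using hw.2
    · rw [abs_lt]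
      constructor <;> nlinarith

lemma neg_mem_sector {ε t : ℝ} (ht : 0 < t) (htε : t < ε) : (-t : ℂ) ∈ sector ε := by
  have hτ := tan_pi_div_eight_gt
  rw [mem_sector_iff]
  refine ⟨by simpa [abs_of_pos ht], ?_⟩
  simp only [Complex.neg_im, Complex.ofReal_im, neg_zero, abs_zero, Complex.neg_re,
    Complex.ofReal_re, neg_neg]
  positivity

lemma isSimplyConnected_sector {ε : ℝ} (hε : 0 < ε) : IsSimplyConnected (sector ε) := by
  have : ContractibleSpace (sector ε) := (convex_sector ε).contractibleSpace
    ⟨_, neg_mem_sector (half_pos hε) (half_lt_self hε)⟩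
  exact SimplyConnectedSpace.ofContractible _

lemma zero_mem_frontier_sector {ε : ℝ} (hε : 0 < ε) : (0 : ℂ) ∈ frontier (sector ε) := by
  rw [(isOpen_sector ε).frontier_eq]
  refine ⟨?_, fun h => by simpa using h.1⟩
  have hlim : Tendsto (fun t : ℝ => (-t : ℂ)) (𝓝[>] 0) (𝓝 0) := by
    have : Continuous fun t : ℝ => (-t : ℂ) := by fun_prop
    simpa using (this.tendsto 0).mono_left nhdsWithin_le_nhds
  refine mem_closure_of_tendsto hlim ?_
  filter_upwards [Ioo_mem_nhdsGT hε] with t ht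
  exact neg_mem_sector ht.1 ht.2

lemma norm_le_two_mul_neg_re {z : ℂ} (hz : |z.im| ≤ Real.tan (Real.pi / 8) * -z.re) :
    0 ≤ -z.re ∧ ‖z‖ ≤ 2 * -z.re := by
  have h1 := tan_pi_div_eight_gt
  have h2 := tan_pi_div_eight_lt
  have h3 : 0 ≤ -z.re := nonneg_of_mul_nonneg_right ((abs_nonneg _).trans hz) (by linarith)
  refine ⟨h3, ?_⟩
  have h4 : |z.re| = -z.re := abs_of_nonpos (by linarith)
  nlinarith [Complex.norm_le_abs_re_add_abs_im z]

/-- As `tan (π / 8) < 1`, the closed sector satisfies `|z| ≤ -2 Re z`, strictly inside the cone away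
from `0`; continuity up to its boundary then comes from holomorphy on the cone. -/
lemma closure_sector_subset {ε δ : ℝ} (h : ε < δ) :
    closure (sector ε) ⊆ insert 0 (truncatedCone δ) := by
  intro z hz
  have hcl : IsClosed {z : ℂ | ‖z‖ ≤ ε ∧ |z.im| ≤ Real.tan (Real.pi / 8) * -z.re} := by
    rw [Set.ofPred_and]
    exact (isClosed_le (by fun_prop) (by fun_prop)).inter
      (isClosed_le (by fun_prop) (by fun_prop))
  have hsub : sector ε ⊆ {z : ℂ | ‖z‖ ≤ ε ∧ |z.im| ≤ Real.tan (Real.pi / 8) * -z.re} :=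
    fun w hw => ⟨(mem_sector_iff.1 hw).1.le, (mem_sector_iff.1 hw).2.le⟩
  obtain ⟨h1, h2⟩ := closure_minimal hsub hcl hz
  by_cases hz0 : z = 0
  · exact .inl hz0
  · have h3 := norm_le_two_mul_neg_re h2
    have h4 := norm_pos_iff.2 hz0
    exact .inr ⟨h1.trans_lt h, by linarith [h3.2]⟩

lemma abs_im_neg_inv_lt_iff {z : ℂ} (hz : z ≠ 0) :
    |(-z⁻¹).im| < Real.tan (Real.pi / 8) * (-z⁻¹).re ↔
      |z.im| < Real.tan (Real.pi / 8) * -z.re := by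
  have h0 : 0 < Complex.normSq z := Complex.normSq_pos.2 hz
  rw [Complex.neg_im, Complex.neg_re, Complex.inv_im, Complex.inv_re, neg_div, neg_neg,
    ← neg_div, abs_div, abs_of_pos h0, ← mul_div_assoc, div_lt_div_iff_of_pos_right h0]

/-- The sector is invariant under `-1 / z ↦ -1 / z + 1 + α` for small `α`. -/
lemma step_mem_sector {ε : ℝ} {z α : ℂ} (hz : z ∈ sector ε) (hα : ‖α‖ ≤ 1 / 5) :
    -(-z⁻¹ + 1 + α)⁻¹ ∈ sector ε := by
  have hτ1 := tan_pi_div_eight_gt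
  have hτ2 := tan_pi_div_eight_lt
  have hz0 : z ≠ 0 := norm_pos_iff.1 hz.1
  obtain ⟨h1, h2⟩ := mem_sector_iff.1 hz
  rw [← abs_im_neg_inv_lt_iff hz0] at h2
  set τ := Real.tan (Real.pi / 8)
  have hzx : ‖z‖ = ‖-z⁻¹‖⁻¹ := by simp
  set x := -z⁻¹ with hx
  have hxre : 0 < x.re := pos_of_mul_pos_right ((abs_nonneg _).trans_lt h2) (by linarith)
  have hx0 : x ≠ 0 := by
    intro h
    simp [h] at hxre
  obtain ⟨a1, a2⟩ := abs_le.1 ((Complex.abs_re_le_norm α).trans hα)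
  obtain ⟨a3, a4⟩ := abs_le.1 ((Complex.abs_im_le_norm α).trans hα)
  obtain ⟨b1, b2⟩ := abs_lt.1 h2
  set y := x + 1 + α with hy
  have hyre : y.re = x.re + 1 + α.re := by simp [hy]
  have hyim : y.im = x.im + α.im := by simp [hy]
  -- The imaginary part changes by at most `1 / 5`, while `τ * Re` gains at least `τ * 4 / 5 > 1 /
  -- 5`, as `τ > 1 / 4`.
  have hyc : |y.im| < τ * y.re := by
    rw [hyre, hyim, abs_lt]
    constructor <;> nlinarith
  have hy0 : y ≠ 0 := by
    intro h
    rw [h] at hyre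
    simp only [Complex.zero_re] at hyre
    linarith
  have hyx : ‖x‖ ≤ ‖y‖ := by
    rw [← sq_le_sq₀ (norm_nonneg _) (norm_nonneg _), Complex.sq_norm, Complex.sq_norm,
      Complex.normSq_apply, Complex.normSq_apply, hyre, hyim]
    have c1 : |x.im * α.im| ≤ x.re * (1 / 5) := by
      rw [abs_mul]
      have : |x.im| ≤ x.re := by nlinarith
      exact mul_le_mul this ((Complex.abs_im_le_norm α).trans hα) (abs_nonneg _) hxre.le
    have c2 := (abs_le.1 c1).1
    nlinarith [sq_nonneg α.im, sq_nonneg (1 + α.re)]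
  rw [mem_sector_iff]
  constructor
  · rw [norm_neg, norm_inv]
    refine lt_of_le_of_lt ?_ h1
    rw [hzx]
    exact inv_anti₀ (norm_pos_iff.2 hx0) hyx
  · rw [← abs_im_neg_inv_lt_iff (by simpa using hy0)]
    simpa using hyc

/-! ### Consequences of the cubic bound: derivative and tangency. -/

lemma norm_deriv_le_of_norm_le_cube {γ : ℂ → ℂ} {δ C ε : ℝ} (hC : 0 ≤ C) (hεδ : 2 * ε ≤ δ)
    (hd : DifferentiableOn ℂ γ (truncatedCone δ))
    (hb : ∀ z ∈ truncatedCone δ, ‖γ z‖ ≤ C * ‖z‖ ^ 3) {z : ℂ} (hz : z ∈ sector ε) :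
    ‖deriv γ z‖ ≤ 16 * C * ‖z‖ ^ 2 := by
  have hz0 := hz.1
  have hre := (norm_le_two_mul_neg_re (mem_sector_iff.1 hz).2.le).2
  -- On this disc `-Re w ≥ (1/2 - 1/8) |z|`, and `4 * 3/8 > 9/8` keeps it in the cone. Cauchy's
  -- factor `8 * (9/8)³` is below `16`.
  have hnear : ∀ w, ‖w - z‖ ≤ ‖z‖ / 8 → ‖w‖ ≤ 9 / 8 * ‖z‖ ∧ w ∈ truncatedCone δ := fun w hw => by
    have h1 := norm_sub_norm_le w z
    have h2 := (abs_le.1 ((Complex.abs_re_le_norm _).trans hw)).2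
    rw [Complex.sub_re] at h2
    have h3 := hz.2.1
    exact ⟨by linarith, by linarith, by linarith⟩
  have hcd : DifferentiableOn ℂ γ (Metric.closedBall z (‖z‖ / 8)) :=
    hd.mono fun w hw => (hnear w (by rwa [← dist_eq_norm])).2
  refine (Complex.norm_deriv_le_of_forall_mem_sphere_norm_le (C := C * (9 / 8 * ‖z‖) ^ 3)
    (by positivity) (hcd.diffContOnCl_ball subset_rfl) fun w hw => ?_).trans ?_
  · obtain ⟨h1, h2⟩ := hnear w (by rw [← dist_eq_norm]; exact (Metric.mem_sphere.1 hw).le)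
    exact (hb w h2).trans (by gcongr)
  · rw [div_le_iff₀ (by positivity)]
    have : 0 ≤ C * ‖z‖ ^ 3 := by positivity
    nlinarith

lemma tendstoDirection_of_norm_le_cube {ι : Type*} {l : Filter ι} {z : ι → ℂ} {w : ι → ℂ} {C : ℝ}
    (hz0 : ∀ᶠ i in l, z i ≠ 0) (hz : Tendsto z l (𝓝 0)) (hw : ∀ᶠ i in l, ‖w i‖ ≤ C * ‖z i‖ ^ 3) :
    TendstoDirection (fun i => (z i, w i)) l (1, 0) := by
  refine ⟨by simp, fun i => (z i)⁻¹, ?_⟩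
  simp only [Prod.smul_mk, smul_eq_mul]
  refine Tendsto.prodMk_nhds ?_ ?_
  · refine tendsto_const_nhds.congr' ?_
    filter_upwards [hz0] with i hi
    exact (inv_mul_cancel₀ hi).symm
  · have hlim : Tendsto (fun i => C * ‖z i‖ ^ 2) l (𝓝 0) := by
      simpa using (hz.norm.pow 2).const_mul C
    refine squeeze_zero_norm' ?_ hlim
    filter_upwards [hz0, hw] with i hi hwi
    have hpos := norm_pos_iff.2 hi
    rw [norm_mul, norm_inv, inv_mul_le_iff₀ hpos]
    exact hwi.trans_eq (by ring)

end ParabolicCurve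

end

/-! ### Assembly of the theorem. -/

theorem mainTheorem4 (F : ℂ × ℂ → ℂ × ℂ) (hF : ParabolicCurve.IsSpecialAutomorphism F) :
    ParabolicCurve.IsNondegenerateCharacteristicDirection F (1, 0) ∧
    ∃ ε₀ : ℝ, 0 < ε₀ ∧ ∃ (γ : ℂ → ℂ) (C₁ C₂ : ℝ), 0 < C₁ ∧ 0 < C₂ ∧
      ∀ ε : ℝ, 0 < ε → ε ≤ ε₀ →
        DifferentiableOn ℂ γ (ParabolicCurve.sector ε) ∧
        ContinuousOn γ (closure (ParabolicCurve.sector ε)) ∧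
        γ 0 = 0 ∧
        ParabolicCurve.IsParabolicCurve F (ParabolicCurve.sector ε) (fun z => (z, γ z)) ∧
        ParabolicCurve.IsTangentAtOrigin (ParabolicCurve.sector ε) (fun z => (z, γ z)) (1, 0) ∧
        (∀ p ∈ ParabolicCurve.curve γ ε,
          F p ∈ ParabolicCurve.curve γ ε ∧
          Tendsto (fun n : ℕ => F^[n] p) atTop (𝓝 0) ∧
          ParabolicCurve.TendstoDirection (fun n : ℕ => F^[n] p) atTop (1, 0)) ∧
        (∀ z ∈ ParabolicCurve.sector ε, ‖γ z‖ ≤ C₁ * ‖z‖ ^ 3) ∧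
        (∀ z ∈ ParabolicCurve.sector ε, ‖deriv γ z‖ ≤ C₂ * ‖z‖ ^ 2) := by
  obtain ⟨δ, C, γ, hδ, hC, hγ0, hγd, hγ⟩ := hF.exists_invariant_graph
  refine ⟨hF.isNondegenerateCharacteristicDirection, δ / 2, by positivity, γ, C, 16 * C, hC,
    by positivity, fun ε hε hεδ => ?_⟩
  have hcl := ParabolicCurve.closure_sector_subset (show ε < δ by linarith)
  have hsub : ParabolicCurve.sector ε ⊆ ParabolicCurve.truncatedCone δ := fun z hz =>
    (hcl (subset_closure hz)).resolve_left (norm_pos_iff.1 hz.1)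
  have hstep : ∀ z ∈ ParabolicCurve.sector ε, ∃ α : ℂ, ‖α‖ ≤ 1 / 5 ∧
      F (z, γ z) = (-(-z⁻¹ + 1 + α)⁻¹, γ (-(-z⁻¹ + 1 + α)⁻¹)) := fun z hz => (hγ z (hsub hz)).2
  -- The lower bound `n / 2` does not depend on `z`, so the convergence to `0` is uniform on the
  -- whole curve.
  have horbit : ∀ z ∈ ParabolicCurve.sector ε, ∀ n : ℕ, ∃ y ∈ ParabolicCurve.sector ε,
      F^[n] (z, γ z) = (y, γ y) ∧ (n : ℝ) / 2 ≤ (-y⁻¹).re := fun z hz n => by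
    induction n with
    | zero =>
      refine ⟨z, hz, rfl, ?_⟩
      have := ParabolicCurve.lt_re_neg_inv_of_mem_truncatedCone (hsub hz)
      refine le_trans ?_ this.le
      simp
    | succ n ih =>
      obtain ⟨y, hy, h1, h2⟩ := ih
      obtain ⟨α, hα, h3⟩ := hstep y hy
      refine ⟨_, ParabolicCurve.step_mem_sector hy hα, by
        rw [Function.iterate_succ_apply', h1, h3], ?_⟩
      have := (abs_le.1 ((Complex.abs_re_le_norm α).trans hα)).1
      simp only [inv_neg, inv_inv, neg_neg, Complex.add_re, Complex.one_re]
      push_cast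
      linarith
  choose! orb horb_mem horb_eq horb_re using horbit
  have horb_norm : ∀ z ∈ ParabolicCurve.sector ε, ∀ n : ℕ, 1 ≤ n → ‖orb z n‖ ≤ 2 / n :=
      fun z hz n hn => by
    have hn : (0 : ℝ) < n := by exact_mod_cast hn
    have h1 := (horb_re z hz n).trans (Complex.re_le_norm _)
    rw [norm_neg, norm_inv, le_inv_comm₀ (by positivity) (horb_mem z hz n).1, inv_div] at h1
    exact h1
  have hbound : ∀ z ∈ ParabolicCurve.sector ε, ∀ n : ℕ, 1 ≤ n →
      ‖F^[n] (z, γ z)‖ ≤ 2 / n + C * (2 / n) ^ 3 := fun z hz n hn => by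
    have h1 := horb_norm z hz n hn
    have h2 := (hγ _ (hsub (horb_mem z hz n))).1
    rw [horb_eq z hz n]
    refine (max_le_add_of_nonneg (norm_nonneg _) (norm_nonneg _)).trans ?_
    refine add_le_add h1 (h2.trans ?_)
    gcongr
  have hlim₁ : Tendsto (fun n : ℕ => (2 : ℝ) / n) atTop (𝓝 0) :=
    tendsto_const_div_atTop_nhds_zero_nat 2
  have hlim : Tendsto (fun n : ℕ => (2 : ℝ) / n + C * (2 / n) ^ 3) atTop (𝓝 0) := by
    simpa using hlim₁.add ((hlim₁.pow 3).const_mul C)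
  have hmaps : ∀ z ∈ ParabolicCurve.sector ε, F (z, γ z) ∈ ParabolicCurve.curve γ ε :=
      fun z hz => by
    obtain ⟨α, hα, h3⟩ := hstep z hz
    exact ⟨_, ParabolicCurve.step_mem_sector hz hα, h3.symm⟩
  have hcont : ContinuousOn γ (closure (ParabolicCurve.sector ε)) := fun z hz => by
    rcases hcl hz with rfl | hz'
    · have h1 : Tendsto (fun z : ℂ => C * ‖z‖ ^ 3) (𝓝[closure (ParabolicCurve.sector ε)] 0)
          (𝓝 0) := by
        have : Continuous fun z : ℂ => C * ‖z‖ ^ 3 := by fun_prop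
        simpa using (this.tendsto 0).mono_left nhdsWithin_le_nhds
      rw [ContinuousWithinAt, hγ0]
      refine squeeze_zero_norm' ?_ h1
      filter_upwards [self_mem_nhdsWithin] with w hw
      rcases hcl hw with rfl | hw'
      · simp [hγ0]
      · exact (hγ w hw').1
    · exact ((hγd z hz').differentiableAt ((ParabolicCurve.isOpen_truncatedCone δ).mem_nhds
        hz')).continuousAt.continuousWithinAt
  have hzero : (0 : ℂ) ∈ closure (ParabolicCurve.sector ε) :=
    frontier_subset_closure (ParabolicCurve.zero_mem_frontier_sector hε)
  refine ⟨hγd.mono hsub, hcont, hγ0, ?_, ?_, ?_, fun z hz => (hγ z (hsub hz)).1, fun z hz =>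
    ParabolicCurve.norm_deriv_le_of_norm_le_cube hC.le (by linarith) hγd
      (fun w hw => (hγ w hw).1) hz⟩
  · refine ⟨ParabolicCurve.isOpen_sector ε, ParabolicCurve.isSimplyConnected_sector hε,
      ParabolicCurve.zero_mem_frontier_sector hε, differentiableOn_id.prodMk (hγd.mono hsub),
      fun z _ w _ h => congrArg Prod.fst h,
      continuousWithinAt_id.prodMk ((hcont 0 hzero).mono subset_closure),
      by simp [hγ0], ?_, ?_⟩
    · rintro _ ⟨z, hz, rfl⟩
      exact hmaps z hz
    · apply TendstoUniformlyOn.tendstoLocallyUniformlyOn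
      rw [Metric.tendstoUniformlyOn_iff]
      intro η hη
      filter_upwards [hlim.eventually_lt_const hη, eventually_ge_atTop 1] with n hn hn1
      rintro _ ⟨z, hz, rfl⟩
      rw [dist_zero_left]
      exact (hbound z hz n hn1).trans_lt hn
  · refine ParabolicCurve.tendstoDirection_of_norm_le_cube (C := C) ?_
      (tendsto_id.mono_left nhdsWithin_le_nhds) ?_
    · filter_upwards [self_mem_nhdsWithin] with z hz using norm_pos_iff.1 hz.1
    · filter_upwards [self_mem_nhdsWithin] with z hz using (hγ z (hsub hz)).1
  · rintro _ ⟨z, hz, rfl⟩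
    refine ⟨hmaps z hz, ?_, ?_⟩
    · refine squeeze_zero_norm' ?_ hlim
      filter_upwards [eventually_ge_atTop 1] with n hn using hbound z hz n hn
    · simp only [horb_eq z hz]
      refine ParabolicCurve.tendstoDirection_of_norm_le_cube (C := C) (.of_forall fun n =>
        norm_pos_iff.1 (horb_mem z hz n).1) ?_ (.of_forall fun n =>
        (hγ _ (hsub (horb_mem z hz n))).1)
      refine squeeze_zero_norm' ?_ hlim₁
      filter_upwards [eventually_ge_atTop 1] with n hn using horb_norm z hz n hn
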